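/- Let $\theta\in[0,1)$ be either $0$ or irrational. If $\theta$ is irrational, assume that its Diophantine exponent $\gamma$ is finite, where $\gamma$ is the infimum of the real $g$ for which $|\theta-p/q|\le q^{-g}$ holds for only finitely many pairs of integers $(p,q)$ with $q\ge 1$; if $\theta=0$, put $\gamma=1$. Let $\psi$ be a positive, decreasing (not necessarily strictly) function on the positive integers for which the limit $\tau=\lambda(\psi):=-\lim_{q\to\infty}\frac{\log\psi(q)}{\log q}$ exists in $\mathbb{R}$, and suppose that $$\tau>\frac{2+\gamma^2+\sqrt{(2+\gamma^2)^2-4}}{2}.$$ Let $\mathrm{Exact}(\psi,\theta)$ be the set of real $x$ such that $\left|x-\frac{r-\theta}{q}\right|\le\psi(q)$ for infinitely many pairs $(r,q)$ of relatively prime integers with $q\ge1$, while for every $c>0$ the inequality $\left|x-\frac{r-\theta}{q}\right|\le\psi(q)-c\,\psi(q)$ holds for only finitely many such pairs. For $E\subset\mathbb{R}$ let the Fourier dimension $\dim_F E$ be the supremum of the $s\in[0,1]$ for which there are a Borel probability measure $\mu$ with compact support contained in $E$ and a constant $C$ such that $|\hat\mu(\xi)|\le C|\xi|^{-s/2}$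 for all real $\xi\ne0$, where $\hat\mu(\xi)=\int e^{-2\pi i x\xi}\,d\mu(x)$ (with $\dim_F E=0$ if there is no such $s$). Then, with $\beta=\gamma^{-2}(\tau-1)^2$, $$\dim_F \mathrm{Exact}(\psi,\theta)\ \ge\ \frac{2(\beta-\tau)}{\tau(\beta-1)}\ >\ 0.$$ Consequently, $\mathrm{Exact}(\psi,\theta)$ contains a normal number, that is, a real number $x$ such that for every integer $b\ge2$ the sequence $(b^n x)_{n\ge0}$ is uniformly distributed modulo $1$. -/

import Mathlib

open Filter Topology MeasureTheory

noncomputable section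

namespace ExactOrder

/-- The pairs `(r, q)` of relatively prime integers, `q ≥ 1`, with `|x - (r - θ) / q| ≤ f q`. -/
def approxPairs (f : ℕ → ℝ) (θ x : ℝ) : Set (ℤ × ℕ) :=
  {p | 1 ≤ p.2 ∧ IsCoprime p.1 (p.2 : ℤ) ∧ |x - ((p.1 : ℝ) - θ) / (p.2 : ℝ)| ≤ f p.2}

/-- The set of (inhomogeneous) exact approximation order `ψ`. -/
def Exact (ψ : ℕ → ℝ) (θ : ℝ) : Set ℝ :=
  {x | (approxPairs ψ θ x).Infinite ∧
    ∀ c : ℝ, 0 < c → (approxPairs (fun q => ψ q - c * ψ q) θ x).Finite}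

/-- `ψ` has order `τ`: the limit defining `λ(ψ) = - lim log ψ(q) / log q` exists and equals `τ`. -/
def HasOrder (ψ : ℕ → ℝ) (τ : ℝ) : Prop :=
  Tendsto (fun q : ℕ => -(Real.log (ψ q) / Real.log (q : ℝ))) atTop (𝓝 τ)

/-- `γ` is the Diophantine approximation exponent of `θ`, i.e. the infimum of those `g` for which
`|θ - p / q| ≤ q ^ (-g)` has only finitely many integer solutions. No real `γ` is a greatest lower
bound of the empty set, so this includes that the exponent is finite. -/
def HasDiophantineExponent (θ γ : ℝ) : Prop :=
  IsGLB {g : ℝ | {p : ℤ × ℕ | 1 ≤ p.2 ∧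
    |θ - (p.1 : ℝ) / (p.2 : ℝ)| ≤ (p.2 : ℝ) ^ (-g)}.Finite} γ

/-- The Fourier transform of a finite Borel measure on the line. -/
def fourierMeasure (μ : Measure ℝ) (ξ : ℝ) : ℂ :=
  ∫ x, Complex.exp (-2 * Real.pi * Complex.I * (x : ℂ) * (ξ : ℂ)) ∂μ

/-- `E` carries a Borel probability measure, with compact support contained in `E`,
whose Fourier transform is `O(|ξ| ^ (-s / 2))`. -/
def SupportsFourierDecay (E : Set ℝ) (s : ℝ) : Prop :=
  ∃ μ : Measure ℝ, IsProbabilityMeasure μ ∧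
    (∃ K : Set ℝ, IsCompact K ∧ K ⊆ E ∧ μ Kᶜ = 0) ∧
    ∃ C : ℝ, ∀ ξ : ℝ, ξ ≠ 0 → ‖fourierMeasure μ ξ‖ ≤ C * |ξ| ^ (-s / 2)

/-- The Fourier dimension of a subset of the line. -/
def fourierDim (E : Set ℝ) : ℝ :=
  sSup {s : ℝ | 0 ≤ s ∧ s ≤ 1 ∧ SupportsFourierDecay E s}

/-- Uniform distribution modulo one of a sequence of real numbers. -/
def EquidistributedModOne (u : ℕ → ℝ) : Prop :=
  ∀ a b : ℝ, 0 ≤ a → a < b → b ≤ 1 →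
    Tendsto (fun N : ℕ =>
        (Nat.card {n : ℕ // n < N ∧ Int.fract (u n) ∈ Set.Ico a b} : ℝ) / (N : ℝ))
      atTop (𝓝 (b - a))

/-- `x` is normal: for every integer base `b ≥ 2`, the sequence `b ^ n * x` is uniformly
distributed modulo one. -/
def IsNormalNumber (x : ℝ) : Prop :=
  ∀ b : ℕ, 2 ≤ b → EquidistributedModOne (fun n => (b : ℝ) ^ n * x)

end ExactOrder

end

/-!
The measure is the limit of products of a smooth bump with kernels of period one. The `k`-th
kernel is an average, over a block of primes `q` of size about `M_k`, of bumps centred just inside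
the right end of the intervals `|x - (r - θ) / q| ≤ ψ q`. An integer has few prime divisors of
that size, so the Fourier coefficients of the average are smaller than those of its terms by
almost the number of primes. When `M_{k+1} = M_k ^ ρ` with `ρ` slightly below `β`, this gain lets
each multiplication preserve Fourier decay of any order below `(β - τ) / (τ (β - 1))`.

Every point of the support is approximated within `ψ q`, and never much better, by one shifted
fraction at each scale. Its other good approximations are excluded because distinct shifted
fractions repel each other, with the Diophantine exponent of `θ`: a gap between consecutive
denominators shorter than the power `β = ((τ - 1) / γ) ^ 2` leaves no room for them. Finally,
power decay of the Fourier transform makes the second moments of the Weyl sums small enough for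
almost every point to be normal.
-/

namespace ExactOrder

open scoped FourierTransform ContDiff

/-! ### Perturbing a decay profile by a periodic kernel -/

/-- The decay profile `min ((1 + |t|) ^ (-σ)) (L ^ (2 - σ) * (1 + |t|) ^ (-2))`: order `σ` up to
the frequency `L`, order two beyond it. It measures the Fourier decay of a smooth density that
resolves details of size `1 / L`. -/
noncomputable def decayWeight (σ L t : ℝ) : ℝ :=
  min ((1 + |t|) ^ (-σ)) (L ^ (2 - σ) * (1 + |t|) ^ (-2 : ℝ))

lemma decayWeight_nonneg {σ L : ℝ} (hL : 0 ≤ L) (t : ℝ) : 0 ≤ decayWeight σ L t :=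
  le_min (by positivity) (by positivity)

lemma decayWeight_pos {σ L : ℝ} (hL : 0 < L) (t : ℝ) : 0 < decayWeight σ L t :=
  lt_min (by positivity) (by positivity)

lemma decayWeight_mono {σ L L' : ℝ} (hσ : σ ≤ 2) (hL : 0 ≤ L) (h : L ≤ L') (t : ℝ) :
    decayWeight σ L t ≤ decayWeight σ L' t := by
  unfold decayWeight
  gcongr

lemma decayWeight_le_one {σ : ℝ} (hσ : 0 ≤ σ) (L t : ℝ) : decayWeight σ L t ≤ 1 :=
  (min_le_left _ _).trans
    (Real.rpow_le_one_of_one_le_of_nonpos (by linarith [abs_nonneg t]) (by linarith))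

lemma one_add_abs_rpow_neg_two_le_decayWeight {σ L : ℝ} (hσ : σ ≤ 2) (hL : 1 ≤ L) (t : ℝ) :
    (1 + |t|) ^ (-2 : ℝ) ≤ decayWeight σ L t :=
  le_min (Real.rpow_le_rpow_of_exponent_le (by linarith [abs_nonneg t]) (by linarith))
    (le_mul_of_one_le_left (by positivity) (Real.one_le_rpow hL (by linarith)))

lemma rpow_neg_le_decayWeight {σ L t : ℝ} (hσ : 0 ≤ σ) (h : 1 + |t| ≤ L) :
    L ^ (-σ) ≤ decayWeight σ L t := by
  have ht : 0 < 1 + |t| := by positivity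
  have hL : 0 < L := ht.trans_le h
  refine le_min (Real.rpow_le_rpow_of_nonpos ht h (by linarith)) ?_
  calc L ^ (-σ) = L ^ (2 - σ) * L ^ (-2 : ℝ) := by rw [← Real.rpow_add hL]; ring_nf
    _ ≤ L ^ (2 - σ) * (1 + |t|) ^ (-2 : ℝ) := by
        gcongr ?_ * ?_
        exact Real.rpow_le_rpow_of_nonpos ht h (by norm_num)

lemma decayWeight_of_le_one_add_abs {σ L t : ℝ} (hσ : σ ≤ 2) (hL : 0 ≤ L) (h : L ≤ 1 + |t|) :
    decayWeight σ L t = L ^ (2 - σ) * (1 + |t|) ^ (-2 : ℝ) := by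
  refine min_eq_right ?_
  calc L ^ (2 - σ) * (1 + |t|) ^ (-2 : ℝ)
      ≤ (1 + |t|) ^ (2 - σ) * (1 + |t|) ^ (-2 : ℝ) := by gcongr
    _ = (1 + |t|) ^ (-σ) := by rw [← Real.rpow_add (by positivity)]; ring_nf

lemma decayWeight_le_rpow_mul_rpow {σ p L : ℝ} (hσ : σ ≤ p) (hp : p ≤ 2) (hL : 0 < L) (t : ℝ) :
    decayWeight σ L t ≤ L ^ (p - σ) * (1 + |t|) ^ (-p) := by
  have ht : 0 < 1 + |t| := by positivity
  rcases le_total (1 + |t|) L with h | h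
  · calc decayWeight σ L t ≤ (1 + |t|) ^ (-σ) := min_le_left _ _
      _ = (1 + |t|) ^ (p - σ) * (1 + |t|) ^ (-p) := by rw [← Real.rpow_add ht]; ring_nf
      _ ≤ L ^ (p - σ) * (1 + |t|) ^ (-p) := by gcongr
  · calc decayWeight σ L t ≤ L ^ (2 - σ) * (1 + |t|) ^ (-2 : ℝ) := min_le_right _ _
      _ = L ^ (p - σ) * (L ^ (2 - p) * (1 + |t|) ^ (-2 : ℝ)) := by
          rw [← mul_assoc, ← Real.rpow_add hL]; ring_nf
      _ ≤ L ^ (p - σ) * ((1 + |t|) ^ (2 - p) * (1 + |t|) ^ (-2 : ℝ)) := by gcongr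
      _ = L ^ (p - σ) * (1 + |t|) ^ (-p) := by rw [← Real.rpow_add ht]; ring_nf

lemma rpow_neg_two_le_four_mul {x y : ℝ} (hx : 0 < x) (h : x / 2 ≤ y) :
    y ^ (-2 : ℝ) ≤ 4 * x ^ (-2 : ℝ) :=
  calc y ^ (-2 : ℝ) ≤ (x / 2) ^ (-2 : ℝ) :=
        Real.rpow_le_rpow_of_nonpos (by positivity) h (by norm_num)
    _ = 4 * x ^ (-2 : ℝ) := by
        rw [Real.div_rpow hx.le zero_le_two, Real.rpow_neg zero_le_two]
        norm_num
        ring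

lemma one_add_abs_add_half_le (s t : ℝ) :
    (1 + |s + t|) / 2 ≤ 1 + |t| ∨ (1 + |s + t|) / 2 ≤ 1 + |s| := by
  have := abs_add_le s t
  by_contra! h
  linarith [h.1, h.2]

/- At high frequency one of `s`, `t` is at least comparable to `s + t`; the corresponding factor
supplies the quadratic decay and the other one the summable tail. -/
lemma decayWeight_zero_mul_decayWeight_le_of_le {σ p L L' s t : ℝ} (hσp : σ ≤ p) (hp0 : 0 ≤ p)
    (hp : p ≤ 2) (hL : 0 < L) (hLL' : L ≤ L') (h : L' ≤ 1 + |s + t|) :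
    decayWeight 0 L' t * decayWeight σ L s ≤ 4 * (L ^ (p - σ) * L' ^ σ) *
      decayWeight σ L' (s + t) * ((1 + |s|) ^ (-p) + (1 + |t|) ^ (-p)) := by
  have hL' : 0 < L' := hL.trans_le hLL'
  rw [decayWeight_of_le_one_add_abs (hσp.trans hp) hL'.le h]
  set w := (1 + |s + t|) ^ (-2 : ℝ)
  have hL'2 : L' ^ (2 : ℝ) = L' ^ σ * L' ^ (2 - σ) := by rw [← Real.rpow_add hL']; ring_nf
  have hs : 0 ≤ (1 + |s|) ^ (-p) := by positivity
  have ht : 0 ≤ (1 + |t|) ^ (-p) := by positivity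
  rcases one_add_abs_add_half_le s t with hst | hst
  · calc decayWeight 0 L' t * decayWeight σ L s
        ≤ (L' ^ (2 - 0 : ℝ) * (4 * w)) * (L ^ (p - σ) * (1 + |s|) ^ (-p)) := by
          gcongr
          · exact decayWeight_nonneg hL.le s
          · exact (min_le_right _ _).trans
              (by gcongr; exact rpow_neg_two_le_four_mul (by positivity) hst)
          · exact decayWeight_le_rpow_mul_rpow hσp hp hL s
      _ = 4 * (L ^ (p - σ) * L' ^ σ) * (L' ^ (2 - σ) * w) * (1 + |s|) ^ (-p) := by
          rw [sub_zero, hL'2]; ring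
      _ ≤ _ := by gcongr; linarith
  · have hscale : L' ^ p * L ^ (2 - σ) ≤ L ^ (p - σ) * (L' ^ σ * L' ^ (2 - σ)) := by
      calc L' ^ p * L ^ (2 - σ) = L' ^ p * (L ^ (p - σ) * L ^ (2 - p)) := by
            rw [← Real.rpow_add hL]; ring_nf
        _ ≤ L' ^ p * (L ^ (p - σ) * L' ^ (2 - p)) := by gcongr
        _ = L ^ (p - σ) * (L' ^ p * L' ^ (2 - p)) := by ring
        _ = L ^ (p - σ) * (L' ^ σ * L' ^ (2 - σ)) := by
            rw [← hL'2, ← Real.rpow_add hL']; ring_nf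
    calc decayWeight 0 L' t * decayWeight σ L s
        ≤ (L' ^ (p - 0) * (1 + |t|) ^ (-p)) * (L ^ (2 - σ) * (4 * w)) := by
          gcongr
          · exact decayWeight_nonneg hL.le s
          · exact decayWeight_le_rpow_mul_rpow hp0 hp hL' t
          · exact (min_le_right _ _).trans
              (by gcongr; exact rpow_neg_two_le_four_mul (by positivity) hst)
      _ = 4 * (L' ^ p * L ^ (2 - σ)) * w * (1 + |t|) ^ (-p) := by rw [sub_zero]; ring
      _ ≤ 4 * (L ^ (p - σ) * (L' ^ σ * L' ^ (2 - σ))) * w * (1 + |t|) ^ (-p) := by gcongr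
      _ = 4 * (L ^ (p - σ) * L' ^ σ) * (L' ^ (2 - σ) * w) * (1 + |t|) ^ (-p) := by ring
      _ ≤ _ := by gcongr; linarith

lemma decayWeight_zero_mul_decayWeight_le {σ p L L' : ℝ} (hσ : 0 ≤ σ) (hσp : σ ≤ p) (hp : p ≤ 2)
    (hL : 0 < L) (hLL' : L ≤ L') (s t : ℝ) :
    decayWeight 0 L' t * decayWeight σ L s ≤ 4 * (L ^ (p - σ) * L' ^ σ) *
      decayWeight σ L' (s + t) * ((1 + |s|) ^ (-p) + (1 + |t|) ^ (-p)) := by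
  have hL' : 0 < L' := hL.trans_le hLL'
  rcases le_total L' (1 + |s + t|) with h | h
  · exact decayWeight_zero_mul_decayWeight_le_of_le hσp (hσ.trans hσp) hp hL hLL' h
  have ht : 0 ≤ (1 + |t|) ^ (-p) := by positivity
  calc decayWeight 0 L' t * decayWeight σ L s ≤ 1 * (L ^ (p - σ) * (1 + |s|) ^ (-p)) := by
        gcongr
        · exact decayWeight_nonneg hL.le s
        · exact decayWeight_le_one le_rfl L' t
        · exact decayWeight_le_rpow_mul_rpow hσp hp hL s
    _ = 1 * (L ^ (p - σ) * (L' ^ σ * L' ^ (-σ))) * (1 + |s|) ^ (-p) := by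
        rw [← Real.rpow_add hL', add_neg_cancel, Real.rpow_zero]; ring
    _ ≤ 4 * (L ^ (p - σ) * (L' ^ σ * decayWeight σ L' (s + t))) *
          ((1 + |s|) ^ (-p) + (1 + |t|) ^ (-p)) := by
        have := decayWeight_nonneg (σ := σ) hL'.le (s + t)
        gcongr
        · norm_num
        · exact rpow_neg_le_decayWeight hσ h
        · linarith
    _ = _ := by ring

lemma summable_one_add_abs_int_rpow {p : ℝ} (hp : 1 < p) :
    Summable fun j : ℤ => (1 + |(j : ℝ)|) ^ (-p) := by
  refine Summable.of_norm_bounded_eventually (Real.summable_abs_int_rpow hp) ?_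
  filter_upwards [(Set.finite_singleton (0 : ℤ)).compl_mem_cofinite] with j hj
  have hj0 : (0 : ℝ) < |(j : ℝ)| := by
    have : j ≠ 0 := by simpa using hj
    positivity
  rw [Real.norm_of_nonneg (by positivity)]
  exact Real.rpow_le_rpow_of_nonpos hj0 (by linarith) (by linarith)

/-- A bound, uniform in `ξ`, for the sums `∑ j, (1 + |ξ - j|) ^ (-p)` over the integers. -/
noncomputable def latticeBound (p : ℝ) : ℝ := ∑' j : ℤ, 2 ^ p * (1 + |(j : ℝ)|) ^ (-p)

lemma latticeBound_pos {p : ℝ} (hp : 1 < p) : 0 < latticeBound p :=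
  ((summable_one_add_abs_int_rpow hp).mul_left _).tsum_pos (fun j => by positivity) 0
    (by positivity)

lemma one_add_abs_sub_add_floor_rpow_le {p : ℝ} (hp : 0 ≤ p) (ξ : ℝ) (j : ℤ) :
    (1 + |ξ - ((j + ⌊ξ⌋ : ℤ) : ℝ)|) ^ (-p) ≤ 2 ^ p * (1 + |(j : ℝ)|) ^ (-p) := by
  have hscale : (2 : ℝ) ^ p * (1 + |(j : ℝ)|) ^ (-p) = ((1 + |(j : ℝ)|) / 2) ^ (-p) := by
    rw [Real.div_rpow (by positivity) zero_le_two, Real.rpow_neg zero_le_two]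
    field_simp
  have hfract : ξ - ((j + ⌊ξ⌋ : ℤ) : ℝ) = Int.fract ξ - j := by
    push_cast; rw [← Int.self_sub_floor]; ring
  have hj : |(j : ℝ)| ≤ |Int.fract ξ - j| + 1 := by
    have := abs_sub_abs_le_abs_sub (j : ℝ) (Int.fract ξ)
    rw [abs_sub_comm, Int.abs_fract] at this
    linarith [Int.fract_lt_one ξ]
  rw [hscale, hfract]
  exact Real.rpow_le_rpow_of_nonpos (by positivity) (by linarith [abs_nonneg (Int.fract ξ - j)])
    (by linarith)

lemma summable_one_add_abs_sub_rpow {p : ℝ} (hp : 1 < p) (ξ : ℝ) :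
    Summable fun j : ℤ => (1 + |ξ - j|) ^ (-p) :=
  (Equiv.summable_iff (Equiv.addRight ⌊ξ⌋)).1 <| Summable.of_nonneg_of_le
    (fun _ => Real.rpow_nonneg (by positivity) _)
    (one_add_abs_sub_add_floor_rpow_le (by linarith) ξ)
    ((summable_one_add_abs_int_rpow hp).mul_left _)

lemma tsum_one_add_abs_sub_rpow_le {p : ℝ} (hp : 1 < p) (ξ : ℝ) :
    ∑' j : ℤ, (1 + |ξ - j|) ^ (-p) ≤ latticeBound p := by
  rw [← Equiv.tsum_eq (Equiv.addRight ⌊ξ⌋) (fun j : ℤ => (1 + |ξ - j|) ^ (-p))]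
  exact Summable.tsum_le_tsum (one_add_abs_sub_add_floor_rpow_le (by linarith) ξ)
    ((Equiv.summable_iff (Equiv.addRight ⌊ξ⌋)).2 (summable_one_add_abs_sub_rpow hp ξ))
    ((summable_one_add_abs_int_rpow hp).mul_left _)

/-- A flat kernel: a nonnegative function with period one and mean one, given by its Fourier series
with coefficients `c`, whose nonzero frequencies have size at most `B` and decay beyond `L`. -/
structure IsFlatKernel (F : ℝ → ℝ) (c : ℤ → ℂ) (B L : ℝ) : Prop where
  nonneg : ∀ x, 0 ≤ F x
  coeff_zero : c 0 = 1
  norm_coeff_le : ∀ j, j ≠ 0 → ‖c j‖ ≤ B * decayWeight 0 L j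
  hasSum : ∀ x : ℝ, HasSum (fun j : ℤ => c j * fourier j (x : UnitAddCircle)) (F x : ℂ)

lemma norm_fourier_apply (j : ℤ) (x : UnitAddCircle) : ‖fourier j x‖ = 1 :=
  (AddCircle.toCircle _).norm_coe

namespace IsFlatKernel

variable {F : ℝ → ℝ} {c : ℤ → ℂ} {B L : ℝ}

lemma bound_nonneg (hF : IsFlatKernel F c B L) (hL : 0 < L) : 0 ≤ B :=
  nonneg_of_mul_nonneg_left ((norm_nonneg _).trans (hF.norm_coeff_le 1 one_ne_zero))
    (decayWeight_pos hL _)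

lemma summable_norm_coeff (hF : IsFlatKernel F c B L) (hL : 0 < L) : Summable fun j => ‖c j‖ := by
  have hB := hF.bound_nonneg hL
  refine Summable.of_norm_bounded_eventually
    ((summable_one_add_abs_int_rpow one_lt_two).mul_left (B * L ^ (2 - 0 : ℝ))) ?_
  filter_upwards [(Set.finite_singleton (0 : ℤ)).compl_mem_cofinite] with j hj
  rw [norm_norm, mul_assoc]
  exact (hF.norm_coeff_le j hj).trans (by gcongr; exact min_le_right _ _)

lemma continuous (hF : IsFlatKernel F c B L) (hL : 0 < L) : Continuous F := by
  have hsum : Continuous fun x : ℝ => ∑' j : ℤ, c j * fourier j (x : UnitAddCircle) :=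
    continuous_tsum
      (fun j =>
        continuous_const.mul ((map_continuous (fourier j)).comp (AddCircle.continuous_mk' 1)))
      (hF.summable_norm_coeff hL) fun j x => by rw [norm_mul, norm_fourier_apply, mul_one]
  refine (Complex.continuous_re.comp hsum).congr fun x => ?_
  simp only [Function.comp_apply, (hF.hasSum x).tsum_eq, Complex.ofReal_re]

end IsFlatKernel

lemma integrable_fourierIntegrand {f : ℝ → ℂ} (hf : Integrable f) (ξ : ℝ) :
    Integrable fun x : ℝ => Complex.exp (↑(-2 * Real.pi * x * ξ) * Complex.I) • f x := by
  have hcont : Continuous fun x : ℝ => Complex.exp (↑(-2 * Real.pi * x * ξ) * Complex.I) := by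
    fun_prop
  exact hf.norm.mono' (hcont.aestronglyMeasurable.smul hf.1)
    (Eventually.of_forall fun x => by rw [norm_smul, Complex.norm_exp_ofReal_mul_I, one_mul])

lemma hasSum_fourier_mul {f F : ℝ → ℂ} {c : ℤ → ℂ} (hf : Integrable f)
    (hc : Summable fun j => ‖c j‖)
    (hF : ∀ x : ℝ, HasSum (fun j : ℤ => c j * fourier j (x : UnitAddCircle)) (F x)) (ξ : ℝ) :
    HasSum (fun j : ℤ => c j * 𝓕 f (ξ - j)) (𝓕 (fun x => f x * F x) ξ) := by
  have hmodulate (x : ℝ) (j : ℤ) :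
      c j * (Complex.exp (↑(-2 * Real.pi * x * (ξ - j)) * Complex.I) • f x) =
        Complex.exp (↑(-2 * Real.pi * x * ξ) * Complex.I) •
          (f x * (c j * fourier j (x : UnitAddCircle))) := by
    have hexp : Complex.exp (↑(-2 * Real.pi * x * (ξ - j)) * Complex.I) =
        Complex.exp (↑(-2 * Real.pi * x * ξ) * Complex.I) * fourier j (x : UnitAddCircle) := by
      rw [fourier_coe_apply, ← Complex.exp_add]
      congr 1
      push_cast
      ring
    simp only [hexp, smul_eq_mul]
    ring
  have hsum := hasSum_integral_of_summable_integral_norm (μ := volume)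
    (fun j : ℤ => (integrable_fourierIntegrand hf (ξ - j)).const_mul (c j)) (by
      simp_rw [norm_mul, norm_smul, Complex.norm_exp_ofReal_mul_I, one_mul, integral_const_mul]
      exact hc.mul_right _)
  simp_rw [integral_const_mul, ← Real.fourier_real_eq_integral_exp_smul, hmodulate] at hsum
  convert! hsum using 1
  rw [Real.fourier_real_eq_integral_exp_smul]
  exact integral_congr_ae (Eventually.of_forall fun x =>
    (((hF x).mul_left (f x)).const_smul _).tsum_eq.symm)

section Perturbation

variable {σ p L L' B C : ℝ} {f : ℝ → ℂ} {F : ℝ → ℝ} {c : ℤ → ℂ}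

lemma norm_coeff_mul_fourier_le (hσ : 0 ≤ σ) (hσp : σ ≤ p) (hp : p ≤ 2) (hL : 0 < L)
    (hLL' : L ≤ L') (hC : 0 ≤ C) (hF : IsFlatKernel F c B L')
    (hfC : ∀ ξ, ‖𝓕 f ξ‖ ≤ C * decayWeight σ L ξ) (ξ : ℝ) {j : ℤ} (hj : j ≠ 0) :
    ‖c j * 𝓕 f (ξ - j)‖ ≤ 4 * (C * (B * L ^ (p - σ) * L' ^ σ)) * decayWeight σ L' ξ *
      ((1 + |ξ - j|) ^ (-p) + (1 + |0 - (j : ℝ)|) ^ (-p)) := by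
  have hL' : 0 < L' := hL.trans_le hLL'
  have hB := hF.bound_nonneg hL'
  have hsplit := decayWeight_zero_mul_decayWeight_le hσ hσp hp hL hLL' (ξ - j) j
  rw [sub_add_cancel] at hsplit
  rw [norm_mul, zero_sub, abs_neg]
  calc ‖c j‖ * ‖𝓕 f (ξ - j)‖ ≤ (B * decayWeight 0 L' j) * (C * decayWeight σ L (ξ - j)) :=
        mul_le_mul (hF.norm_coeff_le j hj) (hfC _) (norm_nonneg _)
          (mul_nonneg hB (decayWeight_nonneg hL'.le _))
    _ = B * C * (decayWeight 0 L' j * decayWeight σ L (ξ - j)) := by ring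
    _ ≤ _ := mul_le_mul_of_nonneg_left hsplit (by positivity)
    _ = _ := by ring

lemma norm_fourier_mul_sub_le (hσ : 0 ≤ σ) (hσp : σ ≤ p) (hp1 : 1 < p) (hp : p ≤ 2) (hL : 0 < L)
    (hLL' : L ≤ L') (hF : IsFlatKernel F c B L') (hf : Integrable f)
    (hfC : ∀ ξ, ‖𝓕 f ξ‖ ≤ C * decayWeight σ L ξ) (ξ : ℝ) :
    ‖𝓕 (fun x => f x * F x) ξ - 𝓕 f ξ‖ ≤
      8 * latticeBound p * (C * (B * L ^ (p - σ) * L' ^ σ)) * decayWeight σ L' ξ := by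
  have hL' : 0 < L' := hL.trans_le hLL'
  have hB := hF.bound_nonneg hL'
  have hC : 0 ≤ C :=
    nonneg_of_mul_nonneg_left ((norm_nonneg _).trans (hfC 0)) (decayWeight_pos hL _)
  set D := 4 * (C * (B * L ^ (p - σ) * L' ^ σ)) * decayWeight σ L' ξ with hD
  have hD0 : 0 ≤ D := mul_nonneg (by positivity) (decayWeight_nonneg hL'.le ξ)
  have hterm (j : ℤ) : ‖c j * 𝓕 f (ξ - j) - (if j = 0 then 𝓕 f ξ else 0)‖ ≤
      D * ((1 + |ξ - j|) ^ (-p) + (1 + |0 - (j : ℝ)|) ^ (-p)) := by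
    split_ifs with hj
    · simp only [hj, hF.coeff_zero, Int.cast_zero, sub_zero, one_mul, sub_self, norm_zero]
      positivity
    · rw [sub_zero]
      exact norm_coeff_mul_fourier_le hσ hσp hp hL hLL' hC hF hfC ξ hj
  have hξ := summable_one_add_abs_sub_rpow hp1 ξ
  have h0 := summable_one_add_abs_sub_rpow hp1 0
  rw [← ((hasSum_fourier_mul hf (hF.summable_norm_coeff hL') hF.hasSum ξ).sub
    (hasSum_ite_eq (0 : ℤ) (𝓕 f ξ))).tsum_eq]
  refine (tsum_of_norm_bounded ((hξ.add h0).mul_left D).hasSum hterm).trans ?_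
  rw [tsum_mul_left, hξ.tsum_add h0]
  calc D * (∑' j : ℤ, (1 + |ξ - j|) ^ (-p) + ∑' j : ℤ, (1 + |0 - (j : ℝ)|) ^ (-p))
      ≤ D * (latticeBound p + latticeBound p) := by
        gcongr
        · exact tsum_one_add_abs_sub_rpow_le hp1 ξ
        · exact tsum_one_add_abs_sub_rpow_le hp1 0
    _ = _ := by rw [hD]; ring

end Perturbation

/-! ### Infinite products of kernels -/

lemma exists_norm_fourier_le_of_contDiff {g : ℝ → ℂ} (hg : ContDiff ℝ ∞ g)
    (hg' : HasCompactSupport g) (k : ℕ) :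
    ∃ C : ℝ, ∀ ξ : ℝ, ‖𝓕 g ξ‖ ≤ C * (1 + |ξ|) ^ (-(k : ℝ)) := by
  let G : SchwartzMap ℝ ℂ := hg'.toSchwartzMap hg
  have hG (ξ : ℝ) : (𝓕 G : SchwartzMap ℝ ℂ) ξ = 𝓕 g ξ := by rw [SchwartzMap.fourier_coe]; rfl
  obtain ⟨C, hC⟩ : ∃ C : ℝ, ∀ ξ : ℝ,
      (1 + ‖ξ‖) ^ k * ‖iteratedFDeriv ℝ 0 (𝓕 G : SchwartzMap ℝ ℂ) ξ‖ ≤ C :=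
    ⟨_, SchwartzMap.one_add_le_sup_seminorm_apply (𝕜 := ℝ) (m := (k, 0)) (k := k) (n := 0)
      le_rfl le_rfl _⟩
  refine ⟨C, fun ξ => ?_⟩
  have hdecay := hC ξ
  rw [norm_iteratedFDeriv_zero, Real.norm_eq_abs, hG] at hdecay
  rw [Real.rpow_neg (by positivity), Real.rpow_natCast, ← div_eq_mul_inv,
    le_div_iff₀ (by positivity), mul_comm]
  exact hdecay

lemma contDiff_ofReal_comp {φ : ℝ → ℝ} (hφ : ContDiff ℝ ∞ φ) :
    ContDiff ℝ ∞ fun x => (φ x : ℂ) :=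
  Complex.ofRealCLM.contDiff.comp hφ

lemma hasCompactSupport_ofReal_comp {φ : ℝ → ℝ} (hφ : HasCompactSupport φ) :
    HasCompactSupport fun x => (φ x : ℂ) :=
  hφ.comp_left Complex.ofReal_zero

lemma exists_smooth_bump (a : ℝ) {r : ℝ} (hr : 0 < r) (k : ℕ) :
    ∃ (φ : ℝ → ℝ) (C : ℝ), ContDiff ℝ ∞ φ ∧ HasCompactSupport φ ∧ (∀ x, 0 ≤ φ x) ∧
      (∀ x ∉ Metric.closedBall a r, φ x = 0) ∧ ∫ x, φ x = 1 ∧ 0 ≤ C ∧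
      ∀ ξ, ‖𝓕 (fun x => (φ x : ℂ)) ξ‖ ≤ C * (1 + |ξ|) ^ (-(k : ℝ)) := by
  let b : ContDiffBump a := ⟨r / 2, r, half_pos hr, half_lt_self hr⟩
  obtain ⟨C, hC⟩ := exists_norm_fourier_le_of_contDiff
    (contDiff_ofReal_comp (b.contDiff_normed (μ := volume)))
    (hasCompactSupport_ofReal_comp (b.hasCompactSupport_normed (μ := volume))) k
  refine ⟨b.normed volume, C, b.contDiff_normed, b.hasCompactSupport_normed,
    b.nonneg_normed, fun x hx => ?_, b.integral_normed,
    nonneg_of_mul_nonneg_left ((norm_nonneg _).trans (hC 0)) (by positivity), hC⟩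
  rw [← Function.notMem_support, b.support_normed_eq]
  exact fun h => hx (Metric.ball_subset_closedBall h)

lemma fourier_ofReal_zero (f : ℝ → ℝ) : 𝓕 (fun x => (f x : ℂ)) 0 = ((∫ x, f x : ℝ) : ℂ) := by
  rw [Real.fourier_real_eq_integral_exp_smul, ← integral_complex_ofReal]
  simp

/-- The measure with density proportional to `f`, scaled to be a probability measure when `f` is
nonnegative with positive integral. -/
noncomputable def normalizedMeasure (f : ℝ → ℝ) : Measure ℝ :=
  volume.withDensity fun x => ENNReal.ofReal ((∫ y, f y)⁻¹ * f x)

section NormalizedMeasure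

variable {f : ℝ → ℝ}

lemma isProbabilityMeasure_normalizedMeasure (hf : Integrable f) (hf0 : ∀ x, 0 ≤ f x)
    (hpos : 0 < ∫ x, f x) : IsProbabilityMeasure (normalizedMeasure f) := by
  refine ⟨?_⟩
  rw [normalizedMeasure, withDensity_apply _ MeasurableSet.univ, Measure.restrict_univ,
    ← ofReal_integral_eq_lintegral_ofReal (hf.const_mul _)
      (Eventually.of_forall fun x => mul_nonneg (inv_nonneg.2 hpos.le) (hf0 x)),
    integral_const_mul, inv_mul_cancel₀ hpos.ne', ENNReal.ofReal_one]

lemma normalizedMeasure_compl_eq_zero {A : Set ℝ} (hA : MeasurableSet A)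
    (hfA : ∀ x ∉ A, f x = 0) : normalizedMeasure f Aᶜ = 0 := by
  rw [normalizedMeasure, withDensity_apply _ hA.compl,
    setLIntegral_congr_fun (g := fun _ => 0) hA.compl (fun x hx => by simp [hfA x hx]),
    lintegral_zero]

lemma fourierMeasure_normalizedMeasure (hf : Measurable f) (hf0 : ∀ x, 0 ≤ f x) (ξ : ℝ) :
    fourierMeasure (normalizedMeasure f) ξ =
      ((∫ y, f y)⁻¹ : ℝ) * 𝓕 (fun x => (f x : ℂ)) ξ := by
  have hdensity (x : ℝ) : 0 ≤ (∫ y, f y)⁻¹ * f x :=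
    mul_nonneg (inv_nonneg.2 (integral_nonneg hf0)) (hf0 x)
  have hcoe : (fun x => ENNReal.ofReal ((∫ y, f y)⁻¹ * f x)) =
      fun x => (((∫ y, f y)⁻¹ * f x).toNNReal : ENNReal) := rfl
  rw [fourierMeasure, normalizedMeasure, hcoe,
    integral_withDensity_eq_integral_smul (by fun_prop), Real.fourier_real_eq_integral_exp_smul,
    ← integral_const_mul]
  refine integral_congr_ae (Eventually.of_forall fun x => ?_)
  simp only [NNReal.smul_def, Real.coe_toNNReal _ (hdensity x), Complex.real_smul, smul_eq_mul]
  push_cast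
  ring_nf

end NormalizedMeasure

section WeakLimits

lemma isCompact_setOf_measure_compl_eq_zero {E : Type*} [MeasurableSpace E] [TopologicalSpace E]
    [T2Space E] [NormalSpace E] [BorelSpace E] {K : Set E} (hK : IsCompact K) :
    IsCompact {μ : ProbabilityMeasure E | (μ : Measure E) Kᶜ = 0} := by
  convert isCompact_setOfPred_probabilityMeasure_mass_eq_compl_isCompact_le (u := fun _ => 0)
    (K := fun _ : ℕ => K) tendsto_const_nhds (fun _ => hK) (Or.inl inferInstance) using 2
  simp

lemma measure_compl_eq_zero_of_tendsto {E ι : Type*} [MeasurableSpace E] [TopologicalSpace E]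
    [HasOuterApproxClosed E] [OpensMeasurableSpace E] {l : Filter ι} [l.NeBot]
    {ν : ι → ProbabilityMeasure E} {μ : ProbabilityMeasure E} (hν : Tendsto ν l (𝓝 μ))
    {A : Set E} (hA : IsClosed A) (hνA : ∀ᶠ i in l, (ν i : Measure E) Aᶜ = 0) :
    (μ : Measure E) Aᶜ = 0 := by
  have hliminf := ProbabilityMeasure.le_liminf_measure_open_of_tendsto hν hA.isOpen_compl
  rw [liminf_congr (v := fun _ => (0 : ENNReal)) hνA, liminf_const] at hliminf
  exact le_antisymm hliminf zero_le

lemma fourierMeasure_eq_charFun (μ : Measure ℝ) (ξ : ℝ) :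
    fourierMeasure μ ξ = charFun μ (-2 * Real.pi * ξ) := by
  rw [fourierMeasure, charFun_apply_real]
  congr with x
  push_cast
  ring_nf

lemma tendsto_fourierMeasure {ν : ℕ → ProbabilityMeasure ℝ} {μ : ProbabilityMeasure ℝ}
    (hν : Tendsto ν atTop (𝓝 μ)) (ξ : ℝ) :
    Tendsto (fun n => fourierMeasure (ν n) ξ) atTop (𝓝 (fourierMeasure μ ξ)) := by
  simp only [fourierMeasure_eq_charFun]
  exact ProbabilityMeasure.tendsto_iff_tendsto_charFun.1 hν _

lemma exists_limit_measure {K : Set ℝ} (hK : IsCompact K) {ν : ℕ → ProbabilityMeasure ℝ}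
    (hν : ∀ n, (ν n : Measure ℝ) Kᶜ = 0) {Z : ℕ → Set ℝ} (hZ : ∀ k, IsClosed (Z k))
    (hνZ : ∀ k n, k < n → (ν n : Measure ℝ) (Z k)ᶜ = 0) {w : ℝ → ℝ}
    (hw : ∀ n ξ, ‖fourierMeasure (ν n) ξ‖ ≤ w ξ) :
    ∃ μ : Measure ℝ, IsProbabilityMeasure μ ∧ μ Kᶜ = 0 ∧ (∀ k, μ (Z k)ᶜ = 0) ∧
      ∀ ξ, ‖fourierMeasure μ ξ‖ ≤ w ξ := by
  obtain ⟨μ, hμK, n, hn, hμ⟩ := (isCompact_setOf_measure_compl_eq_zero hK).tendsto_subseq hν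
  refine ⟨μ, inferInstance, hμK, fun k => ?_, fun ξ => ?_⟩
  · refine measure_compl_eq_zero_of_tendsto hμ (hZ k) ?_
    filter_upwards [hn.tendsto_atTop.eventually_gt_atTop k] with i hi using hνZ k (n i) hi
  · exact le_of_tendsto (tendsto_fourierMeasure hμ ξ).norm
      (Eventually.of_forall fun i => hw (n i) ξ)

end WeakLimits

/-- The density `φ` multiplied by the first `k` kernels of the sequence `F`. -/
noncomputable def partialDensity (φ : ℝ → ℝ) (F : ℕ → ℝ → ℝ) (k : ℕ) (x : ℝ) : ℝ :=
  φ x * ∏ i ∈ Finset.range k, F i x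

section PartialDensity

variable {φ : ℝ → ℝ} {F : ℕ → ℝ → ℝ}

lemma partialDensity_zero : partialDensity φ F 0 = φ := by
  ext x; simp [partialDensity]

lemma partialDensity_succ (k : ℕ) (x : ℝ) :
    partialDensity φ F (k + 1) x = partialDensity φ F k x * F k x := by
  rw [partialDensity, Finset.prod_range_succ, ← mul_assoc, partialDensity]

lemma partialDensity_eq_zero_of_lt {i k : ℕ} (hik : i < k) {x : ℝ} (hx : F i x = 0) :
    partialDensity φ F k x = 0 :=
  mul_eq_zero_of_right _ (Finset.prod_eq_zero (Finset.mem_range.2 hik) hx)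

lemma partialDensity_nonneg (hφ : ∀ x, 0 ≤ φ x) (hF : ∀ k x, 0 ≤ F k x) (k : ℕ) (x : ℝ) :
    0 ≤ partialDensity φ F k x :=
  mul_nonneg (hφ x) (Finset.prod_nonneg fun i _ => hF i x)

lemma continuous_partialDensity (hφ : Continuous φ) (hF : ∀ k, Continuous (F k)) (k : ℕ) :
    Continuous (partialDensity φ F k) :=
  hφ.mul (continuous_finsetProd _ fun i _ => hF i)

lemma integrable_partialDensity (hφ : Continuous φ) (hφc : HasCompactSupport φ)
    (hF : ∀ k, Continuous (F k)) (k : ℕ) : Integrable (partialDensity φ F k) :=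
  (continuous_partialDensity hφ hF k).integrable_of_hasCompactSupport hφc.mul_right

end PartialDensity

/-- The data of an infinite product of kernels: a smooth enough initial density `φ` and flat kernels
`F k` at increasing scales `L k`, each so flat that multiplying by it costs at most `2 ^ (-k)`
relative to the decay of order `σ`. -/
structure IsProductScheme (σ p C : ℝ) (φ : ℝ → ℝ) (F : ℕ → ℝ → ℝ) (c : ℕ → ℤ → ℂ)
    (B L : ℕ → ℝ) : Prop where
  nonneg_exponent : 0 ≤ σ
  exponent_le : σ ≤ p
  one_lt : 1 < p
  le_two : p ≤ 2
  continuous : Continuous φ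
  hasCompactSupport : HasCompactSupport φ
  nonneg : ∀ x, 0 ≤ φ x
  integral_eq_one : ∫ x, φ x = 1
  norm_fourier_le : ∀ ξ, ‖𝓕 (fun x => (φ x : ℂ)) ξ‖ ≤ C * (1 + |ξ|) ^ (-2 : ℝ)
  one_le_scale_zero : 1 ≤ L 0
  monotone_scale : Monotone L
  kernel : ∀ k, IsFlatKernel (F k) (c k) (B k) (L (k + 1))
  small : ∀ k, 64 * latticeBound p * C * (B k * L k ^ (p - σ) * L (k + 1) ^ σ) ≤ (1 / 2) ^ k

namespace IsProductScheme

variable {σ p C : ℝ} {φ : ℝ → ℝ} {F : ℕ → ℝ → ℝ} {c : ℕ → ℤ → ℂ} {B L : ℕ → ℝ}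

lemma one_le_scale (h : IsProductScheme σ p C φ F c B L) (k : ℕ) : 1 ≤ L k :=
  h.one_le_scale_zero.trans (h.monotone_scale (Nat.zero_le k))

lemma scale_pos (h : IsProductScheme σ p C φ F c B L) (k : ℕ) : 0 < L k :=
  one_pos.trans_le (h.one_le_scale k)

lemma continuous_kernel (h : IsProductScheme σ p C φ F c B L) (k : ℕ) : Continuous (F k) :=
  (h.kernel k).continuous (h.scale_pos _)

lemma one_le_const (h : IsProductScheme σ p C φ F c B L) : 1 ≤ C := by
  have hzero := h.norm_fourier_le 0
  rwa [fourier_ofReal_zero, h.integral_eq_one, Complex.ofReal_one, norm_one, abs_zero, add_zero,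
    Real.one_rpow, mul_one] at hzero

lemma norm_fourier_succ_sub_le (h : IsProductScheme σ p C φ F c B L) {k : ℕ}
    (hk : ∀ ξ, ‖𝓕 (fun x => (partialDensity φ F k x : ℂ)) ξ‖ ≤ 2 * C * decayWeight σ (L k) ξ)
    (ξ : ℝ) :
    ‖𝓕 (fun x => (partialDensity φ F (k + 1) x : ℂ)) ξ -
        𝓕 (fun x => (partialDensity φ F k x : ℂ)) ξ‖ ≤
      1 / 4 * (1 / 2) ^ k * decayWeight σ (L (k + 1)) ξ := by
  have hf := (integrable_partialDensity h.continuous h.hasCompactSupport h.continuous_kernel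
    k).ofReal (𝕜 := ℂ)
  simp only [partialDensity_succ, Complex.ofReal_mul]
  refine (norm_fourier_mul_sub_le h.nonneg_exponent h.exponent_le h.one_lt h.le_two (h.scale_pos k)
    (h.monotone_scale (Nat.le_succ k)) (h.kernel k) hf hk ξ).trans
    (mul_le_mul_of_nonneg_right ?_ (decayWeight_nonneg (h.scale_pos _).le ξ))
  linarith [h.small k]

lemma norm_fourier_partialDensity_le (h : IsProductScheme σ p C φ F c B L) (k : ℕ) (ξ : ℝ) :
    ‖𝓕 (fun x => (partialDensity φ F k x : ℂ)) ξ‖ ≤ 2 * C * decayWeight σ (L k) ξ := by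
  have hC := h.one_le_const
  have hW (k : ℕ) (ξ : ℝ) : 0 ≤ decayWeight σ (L k) ξ := decayWeight_nonneg (h.scale_pos k).le ξ
  have hσ2 : σ ≤ 2 := h.exponent_le.trans h.le_two
  have hweaken (k : ℕ) (ξ : ℝ) : (2 - (1 / 2) ^ k) * C * decayWeight σ (L k) ξ ≤
      2 * C * decayWeight σ (L k) ξ := by
    have := hW k ξ
    gcongr
    exact sub_le_self _ (by positivity)
  suffices hsharp : ∀ ξ, ‖𝓕 (fun x => (partialDensity φ F k x : ℂ)) ξ‖ ≤
      (2 - (1 / 2) ^ k) * C * decayWeight σ (L k) ξ from (hsharp ξ).trans (hweaken k ξ)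
  induction k with
  | zero =>
    intro ξ
    rw [partialDensity_zero, pow_zero, show (2 - 1 : ℝ) = 1 by norm_num, one_mul]
    refine (h.norm_fourier_le ξ).trans ?_
    gcongr
    exact one_add_abs_rpow_neg_two_le_decayWeight hσ2 h.one_le_scale_zero ξ
  | succ k ih =>
    intro ξ
    have hstep := h.norm_fourier_succ_sub_le (fun ξ => (ih ξ).trans (hweaken k ξ)) ξ
    have hpow : (1 / 2 : ℝ) ^ k ≤ 1 := pow_le_one₀ (by norm_num) (by norm_num)
    calc ‖𝓕 (fun x => (partialDensity φ F (k + 1) x : ℂ)) ξ‖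
        ≤ ‖𝓕 (fun x => (partialDensity φ F k x : ℂ)) ξ‖ +
          ‖𝓕 (fun x => (partialDensity φ F (k + 1) x : ℂ)) ξ -
            𝓕 (fun x => (partialDensity φ F k x : ℂ)) ξ‖ := norm_le_insert' _ _
      _ ≤ (2 - (1 / 2) ^ k) * C * decayWeight σ (L (k + 1)) ξ +
          1 / 4 * (1 / 2) ^ k * decayWeight σ (L (k + 1)) ξ := by
        refine add_le_add ((ih ξ).trans ?_) hstep
        exact mul_le_mul_of_nonneg_left
          (decayWeight_mono hσ2 (h.scale_pos k).le (h.monotone_scale (Nat.le_succ k)) ξ)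
          (mul_nonneg (by linarith) (by linarith))
      _ = ((2 - (1 / 2) ^ k) * C + 1 / 4 * (1 / 2) ^ k) * decayWeight σ (L (k + 1)) ξ := by ring
      _ ≤ (2 - (1 / 2) ^ (k + 1)) * C * decayWeight σ (L (k + 1)) ξ := by
        refine mul_le_mul_of_nonneg_right ?_ (hW _ ξ)
        have : (1 / 2 : ℝ) ^ k ≤ (1 / 2) ^ k * C := le_mul_of_one_le_right (by positivity) hC
        rw [pow_succ]
        linarith [show (0 : ℝ) ≤ (1 / 2) ^ k by positivity]

lemma half_le_integral (h : IsProductScheme σ p C φ F c B L) (k : ℕ) :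
    1 / 2 ≤ ∫ x, partialDensity φ F k x := by
  suffices hsharp : 1 / 2 + 1 / 2 * (1 / 2) ^ k ≤ ∫ x, partialDensity φ F k x from
    (le_add_of_nonneg_right (by positivity)).trans hsharp
  induction k with
  | zero => rw [partialDensity_zero, h.integral_eq_one]; norm_num
  | succ k ih =>
    have hstep := h.norm_fourier_succ_sub_le (h.norm_fourier_partialDensity_le k) 0
    rw [fourier_ofReal_zero, fourier_ofReal_zero, ← Complex.ofReal_sub, Complex.norm_real,
      Real.norm_eq_abs] at hstep
    have hchange : |(∫ x, partialDensity φ F (k + 1) x) - ∫ x, partialDensity φ F k x| ≤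
        1 / 4 * (1 / 2) ^ k :=
      hstep.trans (mul_le_of_le_one_right (by positivity)
        (decayWeight_le_one h.nonneg_exponent _ _))
    rw [pow_succ]
    linarith [neg_abs_le ((∫ x, partialDensity φ F (k + 1) x) - ∫ x, partialDensity φ F k x)]

lemma norm_fourierMeasure_le (h : IsProductScheme σ p C φ F c B L) (k : ℕ) (ξ : ℝ) :
    ‖fourierMeasure (normalizedMeasure (partialDensity φ F k)) ξ‖ ≤
      4 * C * (1 + |ξ|) ^ (-σ) := by
  have hC := h.one_le_const
  have hmass := h.half_le_integral k
  rw [fourierMeasure_normalizedMeasure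
      (continuous_partialDensity h.continuous h.continuous_kernel k).measurable
      (partialDensity_nonneg h.nonneg (fun k => (h.kernel k).nonneg) k),
    norm_mul, Complex.norm_real, norm_inv, Real.norm_of_nonneg (by linarith)]
  calc (∫ y, partialDensity φ F k y)⁻¹ * ‖𝓕 (fun x => (partialDensity φ F k x : ℂ)) ξ‖
      ≤ (1 / 2)⁻¹ * (2 * C * (1 + |ξ|) ^ (-σ)) := by
        gcongr
        exact (h.norm_fourier_partialDensity_le k ξ).trans (by gcongr; exact min_le_left _ _)
    _ = 4 * C * (1 + |ξ|) ^ (-σ) := by ring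

theorem exists_measure (h : IsProductScheme σ p C φ F c B L) {K : Set ℝ} (hK : IsCompact K)
    (hφK : ∀ x ∉ K, φ x = 0) {Z : ℕ → Set ℝ} (hZ : ∀ k, IsClosed (Z k))
    (hFZ : ∀ k, ∀ x ∉ Z k, F k x = 0) :
    ∃ μ : Measure ℝ, IsProbabilityMeasure μ ∧ μ Kᶜ = 0 ∧ (∀ k, μ (Z k)ᶜ = 0) ∧
      ∀ ξ, ‖fourierMeasure μ ξ‖ ≤ 4 * C * (1 + |ξ|) ^ (-σ) := by
  have hprob (k : ℕ) : IsProbabilityMeasure (normalizedMeasure (partialDensity φ F k)) :=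
    isProbabilityMeasure_normalizedMeasure
      (integrable_partialDensity h.continuous h.hasCompactSupport h.continuous_kernel k)
      (partialDensity_nonneg h.nonneg (fun k => (h.kernel k).nonneg) k)
      (by linarith [h.half_le_integral k])
  exact exists_limit_measure hK (ν := fun k => ⟨_, hprob k⟩)
    (fun k => normalizedMeasure_compl_eq_zero hK.measurableSet fun x hx =>
      mul_eq_zero_of_left (hφK x hx) _) hZ
    (fun k n hkn => normalizedMeasure_compl_eq_zero (hZ k).measurableSet fun x hx =>
      partialDensity_eq_zero_of_lt hkn (hFZ k x hx)) h.norm_fourierMeasure_le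

end IsProductScheme

/-! ### Kernels concentrated near shifted fractions -/

lemma fourier_rescale (φ : ℝ → ℂ) {η : ℝ} (hη : 0 < η) (ξ : ℝ) :
    𝓕 (fun x => (η⁻¹ : ℂ) * φ (x / η)) ξ = 𝓕 φ (η * ξ) := by
  have hintegrand (v : ℝ) :
      Complex.exp (↑(-2 * Real.pi * v * ξ) * Complex.I) • ((η⁻¹ : ℂ) * φ (v / η)) = (η⁻¹ : ℂ) *
        (Complex.exp (↑(-2 * Real.pi * (v / η) * (η * ξ)) * Complex.I) • φ (v / η)) := by
    rw [show -2 * Real.pi * (v / η) * (η * ξ) = -2 * Real.pi * v * ξ by field_simp]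
    simp only [smul_eq_mul]
    ring
  simp only [Real.fourier_real_eq_integral_exp_smul, hintegrand]
  rw [integral_const_mul, Measure.integral_comp_div
    (fun v : ℝ => Complex.exp (↑(-2 * Real.pi * v * (η * ξ)) * Complex.I) • φ v),
    abs_of_pos hη, Complex.real_smul, inv_mul_cancel_left₀ (Complex.ofReal_ne_zero.2 hη.ne')]

/-- The sum of the integer translates of `φ`, rescaled to width `η` with its integral preserved. -/
noncomputable def periodization (φ : ℝ → ℝ) (η y : ℝ) : ℝ :=
  ∑' n : ℤ, η⁻¹ * φ ((y + n) / η)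

section Periodization

variable {φ : ℝ → ℝ} {η : ℝ}

lemma periodization_nonneg (hφ : ∀ x, 0 ≤ φ x) (hη : 0 < η) (y : ℝ) : 0 ≤ periodization φ η y :=
  tsum_nonneg fun _ => mul_nonneg (inv_nonneg.2 hη.le) (hφ _)

lemma exists_int_of_periodization_ne_zero (hφ : ∀ x, 1 < |x| → φ x = 0) (hη : 0 < η) {y : ℝ}
    (hy : periodization φ η y ≠ 0) : ∃ n : ℤ, |y - n| ≤ η := by
  contrapose! hy
  have hterm (n : ℤ) : η⁻¹ * φ ((y + n) / η) = 0 := by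
    rw [hφ, mul_zero]
    simpa [abs_div, abs_of_pos hη, one_lt_div hη] using hy (-n)
  simp only [periodization, hterm, tsum_zero]

lemma hasSum_periodization (hφ : ContDiff ℝ ∞ φ) (hφc : HasCompactSupport φ) (hη : 0 < η) (y : ℝ) :
    HasSum (fun m : ℤ => 𝓕 (fun x => (φ x : ℂ)) (η * m) * fourier m (y : UnitAddCircle))
      (periodization φ η y) := by
  let g : ℝ → ℂ := fun x => (η⁻¹ : ℂ) * φ (x / η)
  have hg : ContDiff ℝ ∞ g :=
    contDiff_const.mul (contDiff_ofReal_comp (hφ.comp (contDiff_id.div_const η)))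
  have hgc : HasCompactSupport g := by
    refine HasCompactSupport.mul_left (hasCompactSupport_ofReal_comp ?_)
    simpa only [div_eq_inv_mul, smul_eq_mul] using hφc.comp_smul (inv_ne_zero hη.ne')
  have hgF (ξ : ℝ) : 𝓕 g ξ = 𝓕 (fun x => (φ x : ℂ)) (η * ξ) :=
    fourier_rescale (fun x => (φ x : ℂ)) hη ξ
  obtain ⟨C, hC⟩ := exists_norm_fourier_le_of_contDiff hg hgc 2
  have hsummable : Summable fun m : ℤ =>
      𝓕 (fun x => (φ x : ℂ)) (η * m) * fourier m (y : UnitAddCircle) :=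
    Summable.of_norm_bounded ((summable_one_add_abs_int_rpow one_lt_two).mul_left C) fun m => by
      rw [norm_mul, ← hgF, norm_fourier_apply, mul_one]
      exact_mod_cast hC m
  have hpoisson := SchwartzMap.tsum_eq_tsum_fourier (hgc.toSchwartzMap hg) y
  have hG (ξ : ℝ) : (𝓕 (hgc.toSchwartzMap hg) : SchwartzMap ℝ ℂ) ξ =
      𝓕 (fun x => (φ x : ℂ)) (η * ξ) := by
    rw [SchwartzMap.fourier_coe, ← hgF]
    rfl
  have hcast : (periodization φ η y : ℂ) = ∑' n : ℤ, (hgc.toSchwartzMap hg) (y + n) := by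
    rw [periodization, Complex.ofReal_tsum]
    exact tsum_congr fun n => by simp [g]
  simp_rw [hG] at hpoisson
  rw [hcast, hpoisson]
  exact hsummable.hasSum

end Periodization

/-- The periodization of `φ` transplanted so that its peaks, of width `δ`, are at the points
`(r - θ) / q + a` with `r` an integer. -/
noncomputable def shiftedKernel (φ : ℝ → ℝ) (θ : ℝ) (q : ℕ) (a δ x : ℝ) : ℝ :=
  periodization φ (q * δ) (q * x + (θ - q * a))

/-- The Fourier coefficients of `shiftedKernel`. -/
noncomputable def shiftedCoeff (φ : ℝ → ℝ) (θ : ℝ) (q : ℕ) (a δ : ℝ) (j : ℤ) : ℂ :=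
  if (q : ℤ) ∣ j then 𝓕 (fun x => (φ x : ℂ)) (δ * j) *
    fourier (j / q) ((θ - q * a : ℝ) : UnitAddCircle) else 0

lemma abs_sub_shifted_fraction_le_iff {q : ℕ} (hq : 0 < q) (θ a δ x : ℝ) (r : ℤ) :
    |x - ((r : ℝ) - θ) / q - a| ≤ δ ↔ |q * x + (θ - q * a) - r| ≤ q * δ := by
  have hq' : (0 : ℝ) < q := Nat.cast_pos.2 hq
  have heq : x - ((r : ℝ) - θ) / q - a = (q * x + (θ - q * a) - r) / q := by
    field_simp
    ring
  rw [heq, abs_div, abs_of_pos hq', div_le_iff₀ hq', mul_comm δ]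

lemma isClosed_setOf_exists_int_near (θ : ℝ) {q : ℕ} (hq : 0 < q) (a δ : ℝ) :
    IsClosed {x : ℝ | ∃ r : ℤ, |x - ((r : ℝ) - θ) / q - a| ≤ δ} := by
  have hset : {x : ℝ | ∃ r : ℤ, |x - ((r : ℝ) - θ) / q - a| ≤ δ} =
      {x : ℝ | ‖((q * x + (θ - q * a) : ℝ) : UnitAddCircle)‖ ≤ q * δ} := by
    ext x
    simp only [Set.mem_ofPred_eq, abs_sub_shifted_fraction_le_iff hq, UnitAddCircle.norm_eq]
    exact ⟨fun ⟨r, hr⟩ => (round_le _ _).trans hr, fun h => ⟨_, h⟩⟩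
  rw [hset]
  refine isClosed_le (continuous_norm.comp ((AddCircle.continuous_mk' 1).comp ?_)) continuous_const
  fun_prop

section ShiftedKernel

variable {φ : ℝ → ℝ} {θ : ℝ} {q : ℕ} {a δ : ℝ}

lemma shiftedKernel_nonneg (hφ : ∀ x, 0 ≤ φ x) (hq : 0 < q) (hδ : 0 < δ) (x : ℝ) :
    0 ≤ shiftedKernel φ θ q a δ x :=
  periodization_nonneg hφ (mul_pos (Nat.cast_pos.2 hq) hδ) _

lemma exists_int_of_shiftedKernel_ne_zero (hφ : ∀ x, 1 < |x| → φ x = 0) (hq : 0 < q) (hδ : 0 < δ)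
    {x : ℝ} (hx : shiftedKernel φ θ q a δ x ≠ 0) : ∃ r : ℤ, |x - ((r : ℝ) - θ) / q - a| ≤ δ := by
  simp only [abs_sub_shifted_fraction_le_iff hq]
  exact exists_int_of_periodization_ne_zero hφ (mul_pos (Nat.cast_pos.2 hq) hδ) hx

lemma hasSum_shiftedKernel (hφ : ContDiff ℝ ∞ φ) (hφc : HasCompactSupport φ) (hq : 0 < q)
    (hδ : 0 < δ) (x : ℝ) :
    HasSum (fun j : ℤ => shiftedCoeff φ θ q a δ j * fourier j (x : UnitAddCircle))
      (shiftedKernel φ θ q a δ x) := by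
  have hq0 : (q : ℤ) ≠ 0 := Nat.cast_ne_zero.2 hq.ne'
  have hinj : Function.Injective fun m : ℤ => (q : ℤ) * m := mul_right_injective₀ hq0
  rw [← hinj.hasSum_iff fun j hj => ?_]
  · refine (hasSum_periodization hφ hφc (mul_pos (Nat.cast_pos.2 hq) hδ)
      (q * x + (θ - q * a))).congr_fun fun m => ?_
    simp only [Function.comp, shiftedCoeff, dvd_mul_right, if_true, Int.mul_ediv_cancel_left _ hq0]
    rw [show δ * (((q : ℤ) * m : ℤ) : ℝ) = q * δ * m by push_cast; ring, mul_assoc]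
    simp only [fourier_coe_apply, ← Complex.exp_add]
    congr 2
    push_cast
    ring
  · have hndvd : ¬ (q : ℤ) ∣ j := fun ⟨m, hm⟩ => hj ⟨m, hm.symm⟩
    simp only [shiftedCoeff, hndvd, if_false, zero_mul]

lemma shiftedCoeff_zero (hφ : ∫ x, φ x = 1) : shiftedCoeff φ θ q a δ 0 = 1 := by
  simp only [shiftedCoeff, dvd_zero, if_true, Int.cast_zero, mul_zero, Int.zero_ediv, fourier_zero,
    mul_one, fourier_ofReal_zero, hφ, Complex.ofReal_one]

lemma norm_shiftedCoeff_le {C L : ℝ}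
    (hφ : ∀ ξ, ‖𝓕 (fun x => (φ x : ℂ)) ξ‖ ≤ C * (1 + |ξ|) ^ (-3 : ℝ)) (hL : 0 < L)
    (hδ : L⁻¹ ≤ δ) (j : ℤ) :
    ‖shiftedCoeff φ θ q a δ j‖ ≤
      if (q : ℤ) ∣ j then C * (1 + L⁻¹ * |(j : ℝ)|) ^ (-3 : ℝ) else 0 := by
  have hδ0 : 0 < δ := (inv_pos.2 hL).trans_le hδ
  have hC : 0 ≤ C := nonneg_of_mul_nonneg_left ((norm_nonneg _).trans (hφ 0)) (by positivity)
  unfold shiftedCoeff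
  split_ifs
  · rw [norm_mul, norm_fourier_apply, mul_one]
    refine (hφ _).trans (mul_le_mul_of_nonneg_left ?_ hC)
    refine Real.rpow_le_rpow_of_nonpos (by positivity) ?_ (by norm_num)
    rw [abs_mul, abs_of_pos hδ0]
    gcongr
  · rw [norm_zero]

end ShiftedKernel

/-! ### Averages over primes -/

lemma card_filter_dvd_mul_log_le {P : Finset ℕ} {Q : ℝ} (hQ : 0 < Q)
    (hP : ∀ q ∈ P, q.Prime ∧ Q ≤ q) {j : ℤ} (hj : j ≠ 0) :
    ((P.filter fun q : ℕ => (q : ℤ) ∣ j).card : ℝ) * Real.log Q ≤ Real.log |(j : ℝ)| := by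
  set S := P.filter fun q : ℕ => (q : ℤ) ∣ j
  have hS (q : ℕ) (hq : q ∈ S) : q ∈ P ∧ (q : ℤ) ∣ j := Finset.mem_filter.1 hq
  have hdvd : ∏ q ∈ S, q ∣ j.natAbs :=
    Finset.prod_primes_dvd _ (fun q hq => (hP q (hS q hq).1).1.prime)
      fun q hq => Int.natCast_dvd.1 (hS q hq).2
  have hpow : Q ^ S.card ≤ |(j : ℝ)| := by
    calc Q ^ S.card = ∏ _q ∈ S, Q := by rw [Finset.prod_const]
      _ ≤ ∏ q ∈ S, (q : ℝ) :=
          Finset.prod_le_prod (fun _ _ => hQ.le) fun q hq => (hP q (hS q hq).1).2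
      _ = ((∏ q ∈ S, q : ℕ) : ℝ) := (Nat.cast_prod _ _).symm
      _ ≤ (j.natAbs : ℝ) := Nat.cast_le.2 (Nat.le_of_dvd (Int.natAbs_pos.2 hj) hdvd)
      _ = |(j : ℝ)| := by rw [Nat.cast_natAbs, Int.cast_abs]
  rw [← Real.log_pow]
  exact Real.log_le_log (by positivity) hpow

lemma card_filter_dvd_le {P : Finset ℕ} {Q L A : ℝ} (hP : ∀ q ∈ P, q.Prime ∧ Q ≤ q)
    (hQ : Real.exp 1 ≤ Q) (hL : 0 < L) (hA : 0 ≤ A) (hLQ : Real.log L ≤ A * Real.log Q) {j : ℤ}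
    (hj : j ≠ 0) :
    ((P.filter fun q : ℕ => (q : ℤ) ∣ j).card : ℝ) ≤ (1 + A) * (1 + L⁻¹ * |(j : ℝ)|) := by
  set t := L⁻¹ * |(j : ℝ)| with ht
  have ht0 : 0 < t := by positivity
  have hQ0 : 0 < Q := (Real.exp_pos 1).trans_le hQ
  have hlogQ : 1 ≤ Real.log Q := (Real.le_log_iff_exp_le hQ0).2 hQ
  have hlogj : Real.log |(j : ℝ)| = Real.log t + Real.log L := by
    rw [← Real.log_mul ht0.ne' hL.ne', ht, mul_right_comm, inv_mul_cancel₀ hL.ne', one_mul]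
  have hmul : ((P.filter fun q : ℕ => (q : ℤ) ∣ j).card : ℝ) * Real.log Q ≤
      (t + A) * Real.log Q := by
    linarith [card_filter_dvd_mul_log_le hQ0 hP hj, Real.log_le_self ht0.le,
      le_mul_of_one_le_right ht0.le hlogQ]
  linarith [le_of_mul_le_mul_right hmul (by linarith), mul_nonneg hA ht0.le]

lemma one_add_inv_mul_rpow_neg_two_le_decayWeight {L : ℝ} (hL : 1 ≤ L) (t : ℝ) :
    (1 + L⁻¹ * |t|) ^ (-2 : ℝ) ≤ decayWeight 0 L t := by
  have hL0 : 0 < L := by linarith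
  have hone : 1 ≤ 1 + L⁻¹ * |t| := le_add_of_nonneg_right (by positivity)
  refine le_min ?_ ?_
  · rw [neg_zero, Real.rpow_zero]
    exact Real.rpow_le_one_of_one_le_of_nonpos hone (by norm_num)
  · calc (1 + L⁻¹ * |t|) ^ (-2 : ℝ) ≤ ((1 + |t|) / L) ^ (-2 : ℝ) := by
          refine Real.rpow_le_rpow_of_nonpos (by positivity) ?_ (by norm_num)
          rw [add_div, inv_mul_eq_div]
          gcongr
          exact (div_le_one hL0).2 hL
      _ = L ^ (2 - 0 : ℝ) * (1 + |t|) ^ (-2 : ℝ) := by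
          rw [Real.div_rpow (by positivity) hL0.le, Real.rpow_neg hL0.le, sub_zero]
          field_simp

/-- The average over `q ∈ P` of the kernels with peaks of width `δ q` at `(r - θ) / q + a q`. -/
noncomputable def averageKernel (φ : ℝ → ℝ) (θ : ℝ) (P : Finset ℕ) (a δ : ℕ → ℝ) (x : ℝ) : ℝ :=
  (P.card : ℝ)⁻¹ * ∑ q ∈ P, shiftedKernel φ θ q (a q) (δ q) x

/-- The Fourier coefficients of `averageKernel`. -/
noncomputable def averageCoeff (φ : ℝ → ℝ) (θ : ℝ) (P : Finset ℕ) (a δ : ℕ → ℝ) (j : ℤ) : ℂ :=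
  (P.card : ℂ)⁻¹ * ∑ q ∈ P, shiftedCoeff φ θ q (a q) (δ q) j

section AverageKernel

variable {φ : ℝ → ℝ} {θ : ℝ} {P : Finset ℕ} {a δ : ℕ → ℝ}

lemma exists_int_of_averageKernel_ne_zero (hφ : ∀ x, 1 < |x| → φ x = 0) (hP : ∀ q ∈ P, 0 < q)
    (hδ : ∀ q ∈ P, 0 < δ q) {x : ℝ} (hx : averageKernel φ θ P a δ x ≠ 0) :
    ∃ q ∈ P, ∃ r : ℤ, |x - ((r : ℝ) - θ) / q - a q| ≤ δ q := by
  obtain ⟨q, hq, hqx⟩ := Finset.exists_ne_zero_of_sum_ne_zero (right_ne_zero_of_mul hx)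
  exact ⟨q, hq, exists_int_of_shiftedKernel_ne_zero hφ (hP q hq) (hδ q hq) hqx⟩

lemma averageCoeff_zero (hφ : ∫ x, φ x = 1) (hP : P.Nonempty) :
    averageCoeff φ θ P a δ 0 = 1 := by
  simp only [averageCoeff, shiftedCoeff_zero hφ, Finset.sum_const, nsmul_eq_mul, mul_one]
  exact inv_mul_cancel₀ (Nat.cast_ne_zero.2 hP.card_ne_zero)

lemma hasSum_averageKernel (hφ : ContDiff ℝ ∞ φ) (hφc : HasCompactSupport φ) (hP : ∀ q ∈ P, 0 < q)
    (hδ : ∀ q ∈ P, 0 < δ q) (x : ℝ) :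
    HasSum (fun j : ℤ => averageCoeff φ θ P a δ j * fourier j (x : UnitAddCircle))
      (averageKernel φ θ P a δ x : ℂ) := by
  have hsum := (hasSum_sum (s := P) fun q hq =>
    hasSum_shiftedKernel (θ := θ) (a := a q) hφ hφc (hP q hq) (hδ q hq) x).mul_left (P.card : ℂ)⁻¹
  simp only [averageKernel, averageCoeff, Complex.ofReal_mul, Complex.ofReal_inv,
    Complex.ofReal_natCast, Complex.ofReal_sum, mul_assoc, Finset.sum_mul]
  exact hsum

/-- A nonzero frequency `j` is seen only by the few primes `q ∈ P` that divide it, so averaging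
over `P` gains almost the full factor `P.card`. -/
lemma norm_averageCoeff_le {C Q L A : ℝ}
    (hφ : ∀ ξ, ‖𝓕 (fun x => (φ x : ℂ)) ξ‖ ≤ C * (1 + |ξ|) ^ (-3 : ℝ))
    (hP : ∀ q ∈ P, q.Prime ∧ Q ≤ q) (hQ : Real.exp 1 ≤ Q) (hL : 1 ≤ L) (hA : 0 ≤ A)
    (hLQ : Real.log L ≤ A * Real.log Q) (hδ : ∀ q ∈ P, L⁻¹ ≤ δ q) {j : ℤ} (hj : j ≠ 0) :
    ‖averageCoeff φ θ P a δ j‖ ≤ C * (1 + A) / P.card * decayWeight 0 L j := by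
  have hL0 : 0 < L := by linarith
  have hC : 0 ≤ C := nonneg_of_mul_nonneg_left ((norm_nonneg _).trans (hφ 0)) (by positivity)
  set t := 1 + L⁻¹ * |(j : ℝ)| with ht
  have ht0 : 0 < t := by positivity
  have hsum : ‖∑ q ∈ P, shiftedCoeff φ θ q (a q) (δ q) j‖ ≤
      (P.filter fun q : ℕ => (q : ℤ) ∣ j).card * (C * t ^ (-3 : ℝ)) := by
    refine (norm_sum_le_of_le _ fun q hq => norm_shiftedCoeff_le hφ hL0 (hδ q hq) j).trans ?_
    rw [← Finset.sum_filter, Finset.sum_const, nsmul_eq_mul]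
  have ht3 : t * t ^ (-3 : ℝ) = t ^ (-2 : ℝ) := by
    rw [← Real.rpow_one_add' ht0.le (by norm_num)]
    norm_num
  rw [averageCoeff, norm_mul, norm_inv, Complex.norm_natCast]
  calc (P.card : ℝ)⁻¹ * ‖∑ q ∈ P, shiftedCoeff φ θ q (a q) (δ q) j‖
      ≤ (P.card : ℝ)⁻¹ * ((1 + A) * t * (C * t ^ (-3 : ℝ))) := by
        gcongr
        exact hsum.trans (by gcongr; exact card_filter_dvd_le hP hQ hL0 hA hLQ hj)
    _ = C * (1 + A) / P.card * t ^ (-2 : ℝ) := by rw [← ht3]; ring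
    _ ≤ C * (1 + A) / P.card * decayWeight 0 L j := by
        gcongr
        exact one_add_inv_mul_rpow_neg_two_le_decayWeight hL j

theorem isFlatKernel_averageKernel {C Q L A : ℝ} (hφ : ContDiff ℝ ∞ φ) (hφc : HasCompactSupport φ)
    (hφ0 : ∀ x, 0 ≤ φ x) (hφ1 : ∫ x, φ x = 1)
    (hφC : ∀ ξ, ‖𝓕 (fun x => (φ x : ℂ)) ξ‖ ≤ C * (1 + |ξ|) ^ (-3 : ℝ)) (hPne : P.Nonempty)
    (hP : ∀ q ∈ P, q.Prime ∧ Q ≤ q) (hQ : Real.exp 1 ≤ Q) (hL : 1 ≤ L) (hA : 0 ≤ A)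
    (hLQ : Real.log L ≤ A * Real.log Q) (hδ : ∀ q ∈ P, L⁻¹ ≤ δ q) :
    IsFlatKernel (averageKernel φ θ P a δ) (averageCoeff φ θ P a δ) (C * (1 + A) / P.card) L := by
  have hpos (q : ℕ) (hq : q ∈ P) : 0 < q := (hP q hq).1.pos
  have hδ0 (q : ℕ) (hq : q ∈ P) : 0 < δ q := (inv_pos.2 (by linarith)).trans_le (hδ q hq)
  exact
    { nonneg := fun x => mul_nonneg (by positivity)
        (Finset.sum_nonneg fun q hq => shiftedKernel_nonneg hφ0 (hpos q hq) (hδ0 q hq) x)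
      coeff_zero := averageCoeff_zero hφ1 hPne
      norm_coeff_le := fun j hj => norm_averageCoeff_le hφC hP hQ hL hA hLQ hδ hj
      hasSum := hasSum_averageKernel hφ hφc hpos hδ0 }

end AverageKernel

/-! ### Diophantine approximation -/

lemma HasOrder.eventually_le {ψ : ℕ → ℝ} {τ τ' : ℝ} (h : HasOrder ψ τ)
    (hψ : ∀ q : ℕ, 1 ≤ q → 0 < ψ q) (hτ : τ' < τ) :
    ∀ᶠ q : ℕ in atTop, ψ q ≤ (q : ℝ) ^ (-τ') := by
  filter_upwards [h.eventually (lt_mem_nhds hτ), eventually_ge_atTop 2] with q hq hq2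
  have hq1 : (1 : ℝ) < q := by exact_mod_cast hq2
  rw [← neg_div, lt_div_iff₀ (Real.log_pos hq1)] at hq
  rw [← Real.log_le_log_iff (hψ q (by lia)) (by positivity), Real.log_rpow (by linarith)]
  linarith

lemma HasOrder.eventually_ge {ψ : ℕ → ℝ} {τ τ' : ℝ} (h : HasOrder ψ τ)
    (hψ : ∀ q : ℕ, 1 ≤ q → 0 < ψ q) (hτ : τ < τ') :
    ∀ᶠ q : ℕ in atTop, (q : ℝ) ^ (-τ') ≤ ψ q := by
  filter_upwards [h.eventually (gt_mem_nhds hτ), eventually_ge_atTop 2] with q hq hq2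
  have hq1 : (1 : ℝ) < q := by exact_mod_cast hq2
  rw [← neg_div, div_lt_iff₀ (Real.log_pos hq1)] at hq
  rw [← Real.log_le_log_iff (by positivity) (hψ q (by lia)), Real.log_rpow (by linarith)]
  linarith

lemma abs_sub_round_mul_div_le (θ : ℝ) {Q : ℝ} (hQ : 0 < Q) :
    |θ - (round (Q * θ) : ℝ) / Q| ≤ Q ^ (-1 : ℝ) := by
  have heq : θ - (round (Q * θ) : ℝ) / Q = (Q * θ - round (Q * θ)) / Q := by field_simp
  rw [heq, abs_div, abs_of_pos hQ, Real.rpow_neg_one, ← one_div]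
  gcongr
  linarith [abs_sub_round (Q * θ)]

lemma one_le_of_finite_approximations {θ g : ℝ}
    (h : {p : ℤ × ℕ | 1 ≤ p.2 ∧ |θ - (p.1 : ℝ) / (p.2 : ℝ)| ≤ (p.2 : ℝ) ^ (-g)}.Finite) :
    1 ≤ g := by
  by_contra! hg
  have hinj : Function.Injective fun q : ℕ => (round (((q + 1 : ℕ) : ℝ) * θ), q + 1) :=
    fun a b hab => by simpa using congrArg Prod.snd hab
  refine Set.infinite_of_injective_forall_mem hinj (fun q => ?_) h
  refine ⟨Nat.le_add_left 1 q, ?_⟩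
  have hq : (1 : ℝ) ≤ ((q + 1 : ℕ) : ℝ) := Nat.one_le_cast.2 (Nat.le_add_left 1 q)
  exact (abs_sub_round_mul_div_le θ (one_pos.trans_le hq)).trans
    (Real.rpow_le_rpow_of_exponent_le hq (by linarith))

lemma HasDiophantineExponent.one_le {θ γ : ℝ} (h : HasDiophantineExponent θ γ) : 1 ≤ γ :=
  h.2 fun _ hg => one_le_of_finite_approximations hg

lemma exists_mul_rpow_le_abs_sub_div {θ g : ℝ} (hθ : Irrational θ)
    (h : {p : ℤ × ℕ | 1 ≤ p.2 ∧ |θ - (p.1 : ℝ) / (p.2 : ℝ)| ≤ (p.2 : ℝ) ^ (-g)}.Finite) :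
    ∃ c : ℝ, 0 < c ∧ c ≤ 1 ∧ ∀ (p : ℤ) (q : ℕ), 1 ≤ q →
      c * (q : ℝ) ^ (-g) ≤ |θ - (p : ℝ) / (q : ℝ)| := by
  have hpos (p : ℤ) (q : ℕ) : 0 < |θ - (p : ℝ) / (q : ℝ)| := by
    rw [abs_pos, sub_ne_zero]
    exact_mod_cast hθ.ne_rat ((p : ℚ) / q)
  obtain ⟨c, hc, hmin⟩ : ∃ c : ℝ, 0 < c ∧ ∀ x ∈ h.toFinset,
      c ≤ |θ - (x.1 : ℝ) / (x.2 : ℝ)| * (x.2 : ℝ) ^ g := by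
    rcases h.toFinset.eq_empty_or_nonempty with hempty | hne
    · exact ⟨1, one_pos, by simp [hempty]⟩
    · obtain ⟨y, hy, hmin⟩ := h.toFinset.exists_min_image
        (fun x => |θ - (x.1 : ℝ) / (x.2 : ℝ)| * (x.2 : ℝ) ^ g) hne
      have hy0 : (0 : ℝ) < y.2 := Nat.cast_pos.2 ((Set.Finite.mem_toFinset h).1 hy).1
      exact ⟨_, mul_pos (hpos _ _) (by positivity), hmin⟩
  refine ⟨min c 1, lt_min hc one_pos, min_le_right _ _, fun p q hq => ?_⟩
  have hq0 : (0 : ℝ) < q := Nat.cast_pos.2 hq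
  by_cases hpq : |θ - (p : ℝ) / (q : ℝ)| ≤ (q : ℝ) ^ (-g)
  · rw [Real.rpow_neg hq0.le, ← div_eq_mul_inv, div_le_iff₀ (by positivity)]
    exact (min_le_left _ _).trans (hmin (p, q) ((Set.Finite.mem_toFinset h).2 ⟨hq, hpq⟩))
  · exact (mul_le_of_le_one_left (by positivity) (min_le_right _ _)).trans (not_le.1 hpq).le

lemma mul_rpow_le_abs_sub_mul {θ g c : ℝ} (hg : 1 ≤ g) (hc : 0 ≤ c) (hc1 : c ≤ 1)
    (h : ∀ (p : ℤ) (q : ℕ), 1 ≤ q → c * (q : ℝ) ^ (-g) ≤ |θ - (p : ℝ) / (q : ℝ)|) {M : ℝ}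
    (hM : 1 ≤ M) {p d : ℤ} (hdM : |(d : ℝ)| ≤ M) (hpd : d = 0 → p ≠ 0) :
    c * M ^ (1 - g) ≤ |p - θ * d| := by
  rcases eq_or_ne d 0 with rfl | hd
  · rw [Int.cast_zero, mul_zero, sub_zero]
    have hp : (1 : ℝ) ≤ |(p : ℝ)| := by exact_mod_cast Int.one_le_abs (hpd rfl)
    exact (mul_le_one₀ hc1 (by positivity)
      (Real.rpow_le_one_of_one_le_of_nonpos hM (by linarith))).trans hp
  have hd0 : 0 < |(d : ℝ)| := abs_pos.2 (Int.cast_ne_zero.2 hd)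
  have hnatAbs : (d.natAbs : ℝ) = |(d : ℝ)| := by rw [Nat.cast_natAbs, Int.cast_abs]
  have hfrac : ((p * d.sign : ℤ) : ℝ) / |(d : ℝ)| = p / d := by
    rw [div_eq_div_iff hd0.ne' (Int.cast_ne_zero.2 hd)]
    exact_mod_cast show p * d.sign * d = p * |d| by rw [mul_assoc, Int.sign_mul_self_eq_abs]
  have happrox := h (p * d.sign) d.natAbs (Int.natAbs_pos.2 hd)
  rw [hnatAbs, hfrac] at happrox
  calc c * M ^ (1 - g) ≤ c * |(d : ℝ)| ^ (1 - g) := mul_le_mul_of_nonneg_left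
        (Real.rpow_le_rpow_of_nonpos hd0 hdM (by linarith)) hc
    _ = |(d : ℝ)| * (c * |(d : ℝ)| ^ (-g)) := by
        rw [sub_eq_add_neg, Real.rpow_add hd0, Real.rpow_one]
        ring
    _ ≤ |(d : ℝ)| * |θ - p / d| := by gcongr
    _ = |p - θ * d| := by
        rw [← abs_mul, mul_sub, mul_div_cancel₀ _ (Int.cast_ne_zero.2 hd), abs_sub_comm, mul_comm θ]

/-- Distinct reduced shifted fractions `(r - θ) / q` and `(r' - θ) / n` repel each other, with
exponent `g` and constant `c`. -/
def Separated (θ g c : ℝ) : Prop :=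
  ∀ (r r' : ℤ) (q n : ℕ), 1 ≤ q → 1 ≤ n → IsCoprime r (q : ℤ) → IsCoprime r' (n : ℤ) →
    (r, q) ≠ (r', n) →
    c / ((q : ℝ) * n * (max q n : ℝ) ^ (g - 1)) ≤ |((r : ℝ) - θ) / q - ((r' : ℝ) - θ) / n|

lemma abs_shifted_sub_eq (θ : ℝ) (r r' : ℤ) {q n : ℕ} (hq : 1 ≤ q) (hn : 1 ≤ n) :
    |((r : ℝ) - θ) / q - ((r' : ℝ) - θ) / n| =
      |((r * n - r' * q : ℤ) : ℝ) - θ * ((n - q : ℤ) : ℝ)| / (q * n) := by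
  have hq0 : (0 : ℝ) < q := Nat.cast_pos.2 hq
  have hn0 : (0 : ℝ) < n := Nat.cast_pos.2 hn
  have heq : ((r : ℝ) - θ) / q - ((r' : ℝ) - θ) / n =
      (((r * n - r' * q : ℤ) : ℝ) - θ * ((n - q : ℤ) : ℝ)) / (q * n) := by
    push_cast
    field_simp
    ring
  rw [heq, abs_div, abs_of_pos (mul_pos hq0 hn0)]

lemma eq_of_mul_eq_mul_of_isCoprime {r r' : ℤ} {q n : ℕ} (hq : 1 ≤ q) (hrq : IsCoprime r (q : ℤ))
    (hrn : IsCoprime r' (n : ℤ)) (h : r * n = r' * q) : (r, q) = (r', n) := by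
  have hqn : (q : ℤ) ∣ n := hrq.symm.dvd_of_dvd_mul_left ⟨r', by rw [h, mul_comm]⟩
  have hnq : (n : ℤ) ∣ q := hrn.symm.dvd_of_dvd_mul_left ⟨r, by rw [← h, mul_comm]⟩
  obtain rfl : q = n :=
    Nat.dvd_antisymm (Int.natCast_dvd_natCast.1 hqn) (Int.natCast_dvd_natCast.1 hnq)
  rw [mul_right_cancel₀ (Nat.cast_ne_zero.2 (Nat.one_le_iff_ne_zero.1 hq)) h]

lemma separated_zero : Separated 0 1 1 := by
  intro r r' q n hq hn hrq hrn hne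
  rw [abs_shifted_sub_eq 0 r r' hq hn, sub_self, Real.rpow_zero, mul_one, zero_mul, sub_zero]
  gcongr
  exact_mod_cast Int.one_le_abs
    (sub_ne_zero.2 fun h => hne (eq_of_mul_eq_mul_of_isCoprime hq hrq hrn h))

lemma exists_separated_of_irrational {θ γ ε : ℝ} (hθ : Irrational θ)
    (hγ : HasDiophantineExponent θ γ) (hε : 0 < ε) :
    ∃ g c : ℝ, 1 ≤ g ∧ g < γ + ε ∧ 0 < c ∧ Separated θ g c := by
  obtain ⟨g, hg, -, hgε⟩ := hγ.exists_between (lt_add_of_pos_right γ hε)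
  have hg1 : 1 ≤ g := one_le_of_finite_approximations hg
  obtain ⟨c, hc, hc1, hcθ⟩ := exists_mul_rpow_le_abs_sub_div hθ hg
  refine ⟨g, c, hg1, hgε, hc, ?_⟩
  intro r r' q n hq hn hrq hrn hne
  have hmax : (1 : ℝ) ≤ max (q : ℝ) n := le_max_of_le_left (Nat.one_le_cast.2 hq)
  have hdM : |((n - q : ℤ) : ℝ)| ≤ max (q : ℝ) n := by
    exact_mod_cast show |(n : ℤ) - q| ≤ max (q : ℤ) n by
      rw [abs_le]
      constructor <;> lia
  rw [abs_shifted_sub_eq θ r r' hq hn, mul_comm, ← div_div]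
  gcongr
  calc c / (max (q : ℝ) n) ^ (g - 1) = c * (max (q : ℝ) n) ^ (1 - g) := by
        rw [div_eq_mul_inv, ← Real.rpow_neg (by linarith), neg_sub]
    _ ≤ _ := mul_rpow_le_abs_sub_mul hg1 hc.le hc1 hcθ hmax hdM fun _ =>
        sub_ne_zero.2 fun h => hne (eq_of_mul_eq_mul_of_isCoprime hq hrq hrn h)

lemma exists_separated {θ γ ε : ℝ} (hγ : (θ = 0 ∧ γ = 1) ∨
    (Irrational θ ∧ HasDiophantineExponent θ γ)) (hε : 0 < ε) :
    ∃ g c : ℝ, 1 ≤ g ∧ g < γ + ε ∧ 0 < c ∧ Separated θ g c := by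
  rcases hγ with ⟨rfl, rfl⟩ | ⟨hirr, hγ⟩
  · exact ⟨1, 1, le_rfl, by linarith, one_pos, separated_zero⟩
  · exact exists_separated_of_irrational hirr hγ hε

/-! ### Exact approximation from a sequence of shifted fractions -/

lemma Separated.mul_rpow_le_rpow_of_near {θ g c t x : ℝ} (hsep : Separated θ g c) (hg : 0 < g)
    (ht : 0 ≤ t) {q n : ℕ} {r r' : ℤ} (hq : 1 ≤ q) (hqn : q ≤ n) (hrq : IsCoprime r (q : ℤ))
    (hrn : IsCoprime r' (n : ℤ)) (hne : (r, q) ≠ (r', n))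
    (hxq : |x - ((r : ℝ) - θ) / q| ≤ (q : ℝ) ^ (-t))
    (hxn : |x - ((r' : ℝ) - θ) / n| ≤ (n : ℝ) ^ (-t)) :
    c / 2 * (q : ℝ) ^ (t - 1) ≤ (n : ℝ) ^ g := by
  have hq0 : (0 : ℝ) < q := Nat.cast_pos.2 hq
  have hqn' : (q : ℝ) ≤ n := Nat.cast_le.2 hqn
  have hn0 : (0 : ℝ) < n := hq0.trans_le hqn'
  have hmono : (n : ℝ) ^ (-t) ≤ (q : ℝ) ^ (-t) :=
    Real.rpow_le_rpow_of_nonpos hq0 hqn' (by linarith)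
  have hdist : |((r : ℝ) - θ) / q - ((r' : ℝ) - θ) / n| ≤ 2 * (q : ℝ) ^ (-t) := by
    have htriangle := abs_sub_le (((r : ℝ) - θ) / q) x (((r' : ℝ) - θ) / n)
    rw [abs_sub_comm _ x] at htriangle
    linarith
  have hrepel := (hsep r r' q n hq (hq.trans hqn) hrq hrn hne).trans hdist
  have hng : (n : ℝ) * (n : ℝ) ^ (g - 1) = (n : ℝ) ^ g := by
    rw [← Real.rpow_one_add' hn0.le (by linarith), add_sub_cancel]
  rw [max_eq_right hqn', mul_assoc, hng, div_le_iff₀ (by positivity)] at hrepel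
  have hcancel : (q : ℝ) ^ (-t) * q * (q : ℝ) ^ (t - 1) = 1 := by
    rw [← Real.rpow_add_one hq0.ne', ← Real.rpow_add hq0, neg_add_eq_sub, sub_add_sub_cancel',
      sub_self, Real.rpow_zero]
  calc c / 2 * (q : ℝ) ^ (t - 1)
      ≤ 2 * (q : ℝ) ^ (-t) * (q * (n : ℝ) ^ g) / 2 * (q : ℝ) ^ (t - 1) := by gcongr
    _ = (q : ℝ) ^ (-t) * q * (q : ℝ) ^ (t - 1) * (n : ℝ) ^ g := by ring
    _ = (n : ℝ) ^ g := by rw [hcancel, one_mul]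

lemma eventually_rpow_lt_mul_rpow {t g b κ : ℝ} (ht : 0 < t) (hg : 0 < g) (hb : b < (t / g) ^ 2)
    (hκ : 0 < κ) :
    ∀ᶠ Q : ℝ in atTop, ∀ n : ℝ, 0 < n → κ * Q ^ t ≤ n ^ g → Q ^ (b * g) < κ * n ^ t := by
  set a := t / g
  have : 0 < a := div_pos ht hg
  have hga : g * a = t := mul_div_cancel₀ _ hg.ne'
  have hs : 0 < t * a - b * g := by
    have := mul_lt_mul_of_pos_right hb hg
    rw [← hga]
    linarith
  filter_upwards [(tendsto_rpow_atTop hs).eventually_gt_atTop (κ ^ (-(1 + a))),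
    eventually_gt_atTop 0] with Q hQ hQ0 n hn hle
  rw [Real.rpow_neg hκ.le, inv_lt_iff_one_lt_mul₀' (by positivity)] at hQ
  calc Q ^ (b * g) < κ ^ (1 + a) * Q ^ (t * a - b * g) * Q ^ (b * g) :=
        lt_mul_of_one_lt_left (by positivity) hQ
    _ = κ * (κ * Q ^ t) ^ a := by
        rw [mul_assoc, ← Real.rpow_add hQ0, sub_add_cancel, Real.mul_rpow hκ.le (by positivity),
          ← Real.rpow_mul hQ0.le, Real.rpow_add hκ, Real.rpow_one, mul_assoc]
    _ ≤ κ * (n ^ g) ^ a := by gcongr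
    _ = κ * n ^ t := by rw [← Real.rpow_mul hn.le, hga]

lemma exists_le_and_lt_succ_of_tendsto_atTop {f : ℕ → ℝ} (hf : Tendsto f atTop atTop) {M : ℝ}
    {k₀ : ℕ} (hk₀ : f k₀ ≤ M) : ∃ l, k₀ ≤ l ∧ f l ≤ M ∧ M < f (l + 1) := by
  by_contra! h
  obtain ⟨k, hkM, hk⟩ := ((hf.eventually_gt_atTop M).and (eventually_ge_atTop k₀)).exists
  exact hkM.not_ge (Nat.le_induction hk₀ h k hk)

lemma infinite_approxPairs_of_tendsto {ψ : ℕ → ℝ} {θ x : ℝ} {q : ℕ → ℕ} {r : ℕ → ℤ}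
    (hq : Tendsto q atTop atTop) (hq1 : ∀ k, 1 ≤ q k) (hcop : ∀ k, IsCoprime (r k) (q k : ℤ))
    (happrox : ∀ k, |x - ((r k : ℝ) - θ) / q k| ≤ ψ (q k)) : (approxPairs ψ θ x).Infinite := by
  intro hfin
  obtain ⟨N, hN⟩ := (hfin.image Prod.snd).bddAbove
  obtain ⟨k, hk⟩ := (hq.eventually_gt_atTop N).exists
  exact hk.not_ge (hN ⟨(r k, q k), ⟨hq1 k, hcop k, happrox k⟩, rfl⟩)

lemma finite_approxPairs_of_bounded (f : ℕ → ℝ) (θ x : ℝ) (n₀ : ℕ)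
    (h : ∀ p ∈ approxPairs f θ x, p.2 < n₀) : (approxPairs f θ x).Finite := by
  refine Set.Finite.subset (Set.Finite.biUnion (Finset.finite_toSet (Finset.range n₀)) fun n _ =>
    (Set.finite_Icc ⌊n * (x - f n) + θ⌋ ⌈n * (x + f n) + θ⌉).image fun r : ℤ => (r, n)) ?_
  rintro ⟨r, n⟩ hp
  obtain ⟨hn, -, happrox⟩ := id hp
  have hn0 : (0 : ℝ) < n := Nat.cast_pos.2 hn
  obtain ⟨hlow, hup⟩ := abs_le.1 happrox
  have hle : (r : ℝ) - θ ≤ n * (x + f n) := by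
    rw [← div_le_iff₀' hn0]
    linarith
  have hge : n * (x - f n) ≤ (r : ℝ) - θ := by
    rw [← le_div_iff₀' hn0]
    linarith
  refine Set.mem_iUnion₂.2 ⟨n, Finset.mem_coe.2 (Finset.mem_range.2 (h _ hp)), r, ⟨?_, ?_⟩, rfl⟩
  · exact Int.floor_le_iff.2 (by linarith)
  · exact Int.le_ceil_iff.2 (by linarith)

/-- If `(r', n)` improves on `ψ` and `l` is the last index with `c / 2 * q l ^ (τ' - 1) ≤ n ^ g`,
then `(r', n)` is so close to `(r (l + 1), q (l + 1))` that the two coincide; but the latter pair is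
nearly optimal. -/
theorem mem_Exact_of_sequence {θ g c τ' b x : ℝ} {ψ : ℕ → ℝ} (hg : 0 < g) (hc : 0 < c)
    (hsep : Separated θ g c) (hψ_pos : ∀ q : ℕ, 1 ≤ q → 0 < ψ q)
    (hψ : ∀ᶠ q : ℕ in atTop, ψ q ≤ (q : ℝ) ^ (-τ')) (hτ' : 1 < τ')
    (hb : b < ((τ' - 1) / g) ^ 2) {q : ℕ → ℕ} {r : ℕ → ℤ} {e : ℕ → ℝ} (hq1 : ∀ k, 1 ≤ q k)
    (hq : Tendsto q atTop atTop) (hqb : ∀ k, (q (k + 1) : ℝ) ≤ (q k : ℝ) ^ b)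
    (hcop : ∀ k, IsCoprime (r k) (q k : ℤ)) (he : Tendsto e atTop (𝓝 0))
    (hlow : ∀ k, (1 - e k) * ψ (q k) ≤ x - ((r k : ℝ) - θ) / q k)
    (hup : ∀ k, |x - ((r k : ℝ) - θ) / q k| ≤ ψ (q k)) :
    x ∈ Exact ψ θ := by
  refine ⟨infinite_approxPairs_of_tendsto hq hq1 hcop hup, fun c' hc' => ?_⟩
  have hqR : Tendsto (fun k => (q k : ℝ)) atTop atTop := tendsto_natCast_atTop_atTop.comp hq
  have hqτ : Tendsto (fun k => c / 2 * (q k : ℝ) ^ (τ' - 1)) atTop atTop :=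
    ((tendsto_rpow_atTop (by linarith)).comp hqR).const_mul_atTop (by positivity)
  have hlate : ∀ᶠ k in atTop, e k < c' ∧ ψ (q k) ≤ (q k : ℝ) ^ (-τ') ∧ ∀ n : ℝ, 0 < n →
      c / 2 * (q k : ℝ) ^ (τ' - 1) ≤ n ^ g → (q k : ℝ) ^ (b * g) < c / 2 * n ^ (τ' - 1) :=
    (he.eventually (gt_mem_nhds hc')).and ((hq.eventually hψ).and (hqR.eventually
      (eventually_rpow_lt_mul_rpow (sub_pos.2 hτ') hg hb (half_pos hc))))
  obtain ⟨k₀, hk₀⟩ := eventually_atTop.1 hlate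
  have hlarge : ∀ᶠ n : ℕ in atTop,
      ψ n ≤ (n : ℝ) ^ (-τ') ∧ c / 2 * (q k₀ : ℝ) ^ (τ' - 1) ≤ (n : ℝ) ^ g :=
    hψ.and (((tendsto_rpow_atTop hg).comp tendsto_natCast_atTop_atTop).eventually_ge_atTop _)
  obtain ⟨n₀, hn₀⟩ := eventually_atTop.1 hlarge
  refine finite_approxPairs_of_bounded _ _ _ n₀ ?_
  rintro ⟨r', n⟩ ⟨hn1, hcop', happrox⟩
  by_contra! hn
  obtain ⟨hψn, hn⟩ := hn₀ n hn
  obtain ⟨l, hl, hln, hnl⟩ := exists_le_and_lt_succ_of_tendsto_atTop hqτ hn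
  obtain ⟨hel, hψl, -⟩ := hk₀ (l + 1) (by lia)
  obtain ⟨-, -, hgap⟩ := hk₀ l hl
  have hne : (r (l + 1), q (l + 1)) ≠ (r', n) := by
    rintro ⟨⟩
    have := (hlow (l + 1)).trans ((le_abs_self _).trans happrox)
    nlinarith [hψ_pos _ (hq1 (l + 1))]
  have hxn : |x - ((r' : ℝ) - θ) / n| ≤ (n : ℝ) ^ (-τ') := by
    linarith [mul_pos hc' (hψ_pos n hn1)]
  have hxl := (hup (l + 1)).trans hψl
  rcases le_total (q (l + 1)) n with hle | hle
  · exact hnl.not_ge (hsep.mul_rpow_le_rpow_of_near hg (by linarith) (hq1 _) hle (hcop _) hcop' hne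
      hxl hxn)
  · refine (hgap n (Nat.cast_pos.2 hn1) hln).not_ge
      ((hsep.mul_rpow_le_rpow_of_near hg (by linarith) hn1 hle hcop' (hcop _) hne.symm hxn
        hxl).trans ?_)
    rw [Real.rpow_mul (Nat.cast_nonneg _)]
    exact Real.rpow_le_rpow (Nat.cast_nonneg _) (hqb l) hg.le

/-! ### Weyl's criterion and normal numbers -/

lemma volume_singleton_unitAddCircle (z : UnitAddCircle) :
    volume ({z} : Set UnitAddCircle) = 0 := by
  simpa using AddCircle.volume_closedBall (T := 1) (x := z) 0

lemma integral_fourier_of_ne_zero {h : ℤ} (hh : h ≠ 0) : ∫ z : UnitAddCircle, fourier h z = 0 :=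
  integral_eq_zero_of_add_right_eq_neg (fourier_add_half_inv_index hh one_pos)

lemma coe_mem_image_Ico_iff {a b : ℝ} (ha : 0 ≤ a) (hb : b ≤ 1) (u : ℝ) :
    (u : UnitAddCircle) ∈ ((↑) '' Set.Ico a b : Set UnitAddCircle) ↔ Int.fract u ∈ Set.Ico a b := by
  refine ⟨?_, fun h => ⟨Int.fract u, h, AddCircle.coe_fract u⟩⟩
  rintro ⟨y, hy, hyu⟩
  have hfract := AddCircle.coe_equivIco_mk_apply (p := (1 : ℝ)) y
  rw [hyu, AddCircle.coe_equivIco_mk_apply, div_one, div_one, mul_one, mul_one,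
    Int.fract_eq_self.2 ⟨ha.trans hy.1, hy.2.trans_le hb⟩] at hfract
  rwa [hfract]

lemma measurableSet_image_Ico {a b : ℝ} (ha : 0 ≤ a) (hb : b ≤ 1) :
    MeasurableSet ((↑) '' Set.Ico a b : Set UnitAddCircle) := by
  have h : ((↑) '' Set.Ico a b : Set UnitAddCircle) =
      (fun z => (AddCircle.equivIco 1 0 z : ℝ)) ⁻¹' Set.Ico a b := by
    ext z
    obtain ⟨y, rfl⟩ := QuotientAddGroup.mk_surjective z
    rw [Set.mem_preimage, AddCircle.coe_equivIco_mk_apply, div_one, mul_one]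
    exact coe_mem_image_Ico_iff ha hb y
  rw [h]
  exact (measurable_subtype_coe.comp (AddCircle.measurableEquivIco 1 0).measurable)
    measurableSet_Ico

lemma volume_image_Ico {a b : ℝ} (ha : 0 ≤ a) (hb : b ≤ 1) :
    volume ((↑) '' Set.Ico a b : Set UnitAddCircle) = ENNReal.ofReal (b - a) := by
  have hmeas := measurableSet_image_Ico ha hb
  rw [← (UnitAddCircle.measurePreserving_mk 0).measure_preimage hmeas.nullMeasurableSet,
    ← Measure.restrict_congr_set (Ico_ae_eq_Ioc (α := ℝ) (μ := volume)),
    Measure.restrict_apply (hmeas.preimage AddCircle.measurable_mk'), ← Real.volume_Ico, zero_add]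
  congr 1
  ext y
  rw [Set.mem_inter_iff, Set.mem_preimage, coe_mem_image_Ico_iff ha hb]
  constructor
  · rintro ⟨hy, hy01⟩
    rwa [Int.fract_eq_self.2 hy01] at hy
  · intro hy
    have hy01 : y ∈ Set.Ico (0 : ℝ) 1 := ⟨ha.trans hy.1, hy.2.trans_le hb⟩
    exact ⟨by rwa [Int.fract_eq_self.2 hy01], hy01⟩

lemma volume_frontier_image_Ico (a b : ℝ) :
    volume (frontier ((↑) '' Set.Ico a b : Set UnitAddCircle)) = 0 := by
  have hclosed : IsClosed ((↑) '' Set.Icc a b : Set UnitAddCircle) :=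
    (isCompact_Icc.image (AddCircle.continuous_mk' 1)).isClosed
  have hopen : IsOpen ((↑) '' Set.Ioo a b : Set UnitAddCircle) :=
    QuotientAddGroup.isOpenMap_coe _ isOpen_Ioo
  refine measure_mono_null (t := {(a : UnitAddCircle)} ∪ {(b : UnitAddCircle)}) ?_
    (measure_union_null (volume_singleton_unitAddCircle _) (volume_singleton_unitAddCircle _))
  rintro z ⟨hz, hz'⟩
  obtain ⟨y, hy, rfl⟩ := closure_minimal (Set.image_mono Set.Ico_subset_Icc_self) hclosed hz
  rcases hy.1.eq_or_lt with rfl | hay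
  · exact Or.inl rfl
  rcases hy.2.eq_or_lt with rfl | hyb
  · exact Or.inr rfl
  exact absurd (interior_maximal (Set.image_mono Set.Ioo_subset_Ico_self) hopen
    ⟨y, ⟨hay, hyb⟩, rfl⟩) hz'

/-- The uniform probability measure on the first `N + 1` terms of a sequence; the shift by one
avoids the empty average. -/
noncomputable def empiricalMeasure (u : ℕ → UnitAddCircle) (N : ℕ) : Measure UnitAddCircle :=
  ((N + 1 : ℕ) : ENNReal)⁻¹ • ∑ n ∈ Finset.range (N + 1), Measure.dirac (u n)

instance (u : ℕ → UnitAddCircle) (N : ℕ) : IsProbabilityMeasure (empiricalMeasure u N) := by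
  refine ⟨?_⟩
  simp only [empiricalMeasure, Measure.smul_apply, Measure.finsetSum_apply, measure_univ,
    Finset.sum_const, Finset.card_range, smul_eq_mul, nsmul_eq_mul, mul_one]
  exact ENNReal.inv_mul_cancel (by simp) (by simp)

/-- The empirical measure as a bundled probability measure. -/
noncomputable def empiricalProbability (u : ℕ → UnitAddCircle) (N : ℕ) :
    ProbabilityMeasure UnitAddCircle := ⟨empiricalMeasure u N, inferInstance⟩

/-- Lebesgue measure on the circle as a bundled probability measure. -/
noncomputable def circleProbability : ProbabilityMeasure UnitAddCircle :=
  ⟨volume, ⟨UnitAddCircle.measure_univ⟩⟩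

lemma integral_empiricalMeasure (u : ℕ → UnitAddCircle) (N : ℕ) (g : C(UnitAddCircle, ℂ)) :
    ∫ z, g z ∂(empiricalMeasure u N) =
      ((N + 1 : ℕ) : ℂ)⁻¹ * ∑ n ∈ Finset.range (N + 1), g (u n) := by
  rw [empiricalMeasure, integral_smul_measure,
    integral_finsetSum_measure fun i _ => integrable_dirac (by simp), ENNReal.toReal_inv,
    ENNReal.toReal_natCast, Complex.real_smul]
  simp only [integral_dirac, Complex.ofReal_inv, Complex.ofReal_natCast]

lemma toReal_empiricalMeasure_apply (u : ℕ → UnitAddCircle) (N : ℕ) {s : Set UnitAddCircle}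
    (hs : MeasurableSet s) :
    (empiricalMeasure u N s).toReal = (Nat.card {n // n < N + 1 ∧ u n ∈ s} : ℝ) / (N + 1 : ℕ) := by
  classical
  have hcard : Nat.card {n // n < N + 1 ∧ u n ∈ s} =
      ((Finset.range (N + 1)).filter fun n => u n ∈ s).card := by
    rw [Nat.subtype_card]
    simp
  simp only [empiricalMeasure, Measure.smul_apply, Measure.finsetSum_apply, smul_eq_mul,
    Measure.dirac_apply' _ hs, Set.indicator_apply, Pi.one_apply]
  rw [Finset.sum_boole, ENNReal.toReal_mul, ENNReal.toReal_inv, ENNReal.toReal_natCast,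
    ENNReal.toReal_natCast, hcard, div_eq_inv_mul]

lemma tendsto_integral_empiricalMeasure {u : ℕ → UnitAddCircle}
    (hu : ∀ h : ℤ, h ≠ 0 → Tendsto (fun N : ℕ =>
      ((N + 1 : ℕ) : ℂ)⁻¹ * ∑ n ∈ Finset.range (N + 1), fourier h (u n)) atTop (𝓝 0))
    {G : C(UnitAddCircle, ℂ)} (hG : G ∈ Submodule.span ℂ (Set.range (@fourier 1))) :
    Tendsto (fun N => ∫ z, G z ∂(empiricalMeasure u N)) atTop (𝓝 (∫ z, G z)) := by
  have hint (G : C(UnitAddCircle, ℂ)) (ν : Measure UnitAddCircle) [IsFiniteMeasure ν] :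
      Integrable G ν := (BoundedContinuousFunction.mkOfCompact G).integrable ν
  induction hG using Submodule.span_induction with
  | mem G hG =>
    obtain ⟨h, rfl⟩ := hG
    rcases eq_or_ne h 0 with rfl | hh
    · simp [measureReal_def]
    · simp_rw [integral_empiricalMeasure, integral_fourier_of_ne_zero hh]
      exact hu h hh
  | zero => simp
  | add G H _ _ hG hH =>
    simp only [ContinuousMap.add_apply, integral_add (hint G _) (hint H _)]
    exact hG.add hH
  | smul c G _ hG =>
    simp only [ContinuousMap.smul_apply, integral_smul]
    exact hG.const_smul c

lemma tendsto_empiricalProbability {u : ℕ → UnitAddCircle}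
    (hu : ∀ h : ℤ, h ≠ 0 → Tendsto (fun N : ℕ =>
      ((N + 1 : ℕ) : ℂ)⁻¹ * ∑ n ∈ Finset.range (N + 1), fourier h (u n)) atTop (𝓝 0)) :
    Tendsto (empiricalProbability u) atTop (𝓝 circleProbability) := by
  refine ProbabilityMeasure.tendsto_of_tight_of_separatesPoints ℂ
    IsTightMeasureSet.of_compactSpace
    (A := (fourierSubalgebra (T := 1)).comap (BoundedContinuousFunction.toContinuousMapStarₐ ℂ))
    (fun x y hxy => ?_) fun g hg => ?_
  · obtain ⟨_, ⟨f, hf, rfl⟩, hfxy⟩ := fourierSubalgebra_separatesPoints (T := 1) hxy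
    exact ⟨f, ⟨f, ⟨BoundedContinuousFunction.mkOfCompact f, hf, rfl⟩, rfl⟩, hfxy⟩
  · refine tendsto_integral_empiricalMeasure (G := g.toContinuousMap) hu ?_
    rw [← fourierSubalgebra_coe]
    exact hg

lemma tendsto_toReal_empiricalMeasure {u : ℕ → UnitAddCircle}
    (hu : ∀ h : ℤ, h ≠ 0 → Tendsto (fun N : ℕ =>
      ((N + 1 : ℕ) : ℂ)⁻¹ * ∑ n ∈ Finset.range (N + 1), fourier h (u n)) atTop (𝓝 0))
    {s : Set UnitAddCircle} (hs : volume (frontier s) = 0) :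
    Tendsto (fun N => (empiricalMeasure u N s).toReal) atTop (𝓝 (volume s).toReal) :=
  (ENNReal.tendsto_toReal (measure_ne_top volume s)).comp
    (ProbabilityMeasure.tendsto_measure_of_null_frontier_of_tendsto'
      (tendsto_empiricalProbability hu) hs)

theorem equidistributedModOne_of_weyl {u : ℕ → ℝ}
    (hu : ∀ h : ℤ, h ≠ 0 → Tendsto (fun N : ℕ =>
      (N : ℂ)⁻¹ * ∑ n ∈ Finset.range N, fourier h (u n : UnitAddCircle)) atTop (𝓝 0)) :
    EquidistributedModOne u := by
  intro a b ha hab hb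
  have harc := tendsto_toReal_empiricalMeasure (u := fun n => (u n : UnitAddCircle))
    (fun h hh => (tendsto_add_atTop_iff_nat 1).2 (hu h hh)) (volume_frontier_image_Ico a b)
  rw [volume_image_Ico ha hb, ENNReal.toReal_ofReal (sub_nonneg.2 hab.le)] at harc
  refine (tendsto_add_atTop_iff_nat 1).1 (harc.congr fun N => ?_)
  simp only [toReal_empiricalMeasure_apply _ N (measurableSet_image_Ico ha hb),
    coe_mem_image_Ico_iff ha hb]

/-- The exponential sum of the orbit `b ^ n * x`, `n < N`, at the frequency `h`. -/
noncomputable def weylSum (b : ℕ) (h : ℤ) (N : ℕ) (x : ℝ) : ℂ :=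
  ∑ n ∈ Finset.range N, fourier h (((b : ℝ) ^ n * x : ℝ) : UnitAddCircle)

lemma continuous_fourier_mul (h : ℤ) (s : ℝ) :
    Continuous fun x : ℝ => fourier h ((s * x : ℝ) : UnitAddCircle) :=
  (map_continuous (fourier h)).comp ((AddCircle.continuous_mk' 1).comp (by fun_prop))

lemma continuous_weylSum (b : ℕ) (h : ℤ) (N : ℕ) : Continuous (weylSum b h N) :=
  continuous_finsetSum _ fun n _ => continuous_fourier_mul h ((b : ℝ) ^ n)

lemma norm_weylSum_sub_le (b : ℕ) (h : ℤ) {M N : ℕ} (hMN : M ≤ N) (x : ℝ) :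
    ‖weylSum b h N x - weylSum b h M x‖ ≤ N - M := by
  rw [weylSum, weylSum, ← Finset.sum_Ico_eq_sub _ hMN]
  refine (norm_sum_le _ _).trans ?_
  simp only [norm_fourier_apply, Finset.sum_const, Nat.card_Ico, nsmul_eq_mul, mul_one,
    Nat.cast_sub hMN, le_refl]

lemma norm_weylSum_le (b : ℕ) (h : ℤ) (N : ℕ) (x : ℝ) : ‖weylSum b h N x‖ ≤ N := by
  simpa [weylSum] using norm_weylSum_sub_le b h (Nat.zero_le N) x

lemma two_rpow_le_abs_pow_sub_pow {b : ℕ} (hb : 2 ≤ b) {m n : ℕ} (hmn : m ≠ n) :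
    (2 : ℝ) ^ (((m : ℝ) + n) / 2 - 1) ≤ |(b : ℝ) ^ n - (b : ℝ) ^ m| := by
  wlog h : m < n generalizing m n
  · rw [abs_sub_comm, add_comm (m : ℝ)]
    exact this hmn.symm (hmn.lt_or_gt.resolve_left h)
  have hb' : (2 : ℝ) ≤ b := Nat.ofNat_le_cast.2 hb
  have hdouble : 2 * (b : ℝ) ^ m ≤ (b : ℝ) ^ n := by
    calc 2 * (b : ℝ) ^ m ≤ b * (b : ℝ) ^ m := by gcongr
      _ = (b : ℝ) ^ (m + 1) := (pow_succ' _ _).symm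
      _ ≤ (b : ℝ) ^ n := pow_le_pow_right₀ (by linarith) h
  calc (2 : ℝ) ^ (((m : ℝ) + n) / 2 - 1) ≤ (2 : ℝ) ^ ((n : ℝ) - 1) :=
        Real.rpow_le_rpow_of_exponent_le one_le_two (by
          have : (m : ℝ) ≤ n := Nat.cast_le.2 h.le
          linarith)
    _ = (2 : ℝ) ^ n / 2 := by rw [Real.rpow_sub_one two_ne_zero, Real.rpow_natCast]
    _ ≤ (b : ℝ) ^ n / 2 := by gcongr
    _ ≤ (b : ℝ) ^ n - (b : ℝ) ^ m := by linarith
    _ ≤ |(b : ℝ) ^ n - (b : ℝ) ^ m| := le_abs_self _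

lemma integral_fourier_mul_conj (μ : Measure ℝ) (h : ℤ) (s t : ℝ) :
    ∫ x, fourier h ((s * x : ℝ) : UnitAddCircle) *
      (starRingEnd ℂ) (fourier h ((t * x : ℝ) : UnitAddCircle)) ∂μ =
      fourierMeasure μ (h * (t - s)) := by
  refine integral_congr_ae (Eventually.of_forall fun x => ?_)
  beta_reduce
  rw [← fourier_neg, fourier_coe_apply, fourier_coe_apply, ← Complex.exp_add]
  congr 1
  push_cast
  ring

lemma integral_norm_weylSum_sq (μ : Measure ℝ) [IsFiniteMeasure μ] (b : ℕ) (h : ℤ) (N : ℕ) :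
    ((∫ x, ‖weylSum b h N x‖ ^ 2 ∂μ : ℝ) : ℂ) =
      ∑ m ∈ Finset.range N, ∑ n ∈ Finset.range N,
        fourierMeasure μ (h * ((b : ℝ) ^ n - (b : ℝ) ^ m)) := by
  have hint (s t : ℝ) : Integrable (fun x : ℝ => fourier h ((s * x : ℝ) : UnitAddCircle) *
      (starRingEnd ℂ) (fourier h ((t * x : ℝ) : UnitAddCircle))) μ := by
    refine Integrable.of_bound ((continuous_fourier_mul h s).mul (Complex.continuous_conj.comp
      (continuous_fourier_mul h t))).aestronglyMeasurable 1 (Eventually.of_forall fun x => ?_)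
    rw [norm_mul, RCLike.norm_conj, norm_fourier_apply, norm_fourier_apply, one_mul]
  rw [← integral_complex_ofReal]
  simp only [Complex.ofReal_pow, ← Complex.mul_conj', weylSum, map_sum, Finset.sum_mul_sum]
  rw [integral_finsetSum _ fun m _ => integrable_finsetSum _ fun n _ => hint _ _]
  refine Finset.sum_congr rfl fun m _ => ?_
  rw [integral_finsetSum _ fun n _ => hint _ _]
  exact Finset.sum_congr rfl fun n _ => integral_fourier_mul_conj μ h _ _

lemma norm_fourierMeasure_mul_pow_sub_pow_le {μ : Measure ℝ} {C σ : ℝ} (hσ : 0 ≤ σ)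
    (hμ : ∀ ξ : ℝ, ξ ≠ 0 → ‖fourierMeasure μ ξ‖ ≤ C * |ξ| ^ (-σ)) {b : ℕ} (hb : 2 ≤ b) {h : ℤ}
    (hh : h ≠ 0) {m n : ℕ} (hmn : m ≠ n) :
    ‖fourierMeasure μ (h * ((b : ℝ) ^ n - (b : ℝ) ^ m))‖ ≤
      C * 2 ^ σ * (((2 : ℝ) ^ (-(σ / 2))) ^ m * ((2 : ℝ) ^ (-(σ / 2))) ^ n) := by
  have hC : 0 ≤ C := by simpa using (norm_nonneg _).trans (hμ 1 one_ne_zero)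
  have hpow : (0 : ℝ) < (2 : ℝ) ^ (((m : ℝ) + n) / 2 - 1) := by positivity
  have hfreq : (2 : ℝ) ^ (((m : ℝ) + n) / 2 - 1) ≤ |h * ((b : ℝ) ^ n - (b : ℝ) ^ m)| := by
    rw [abs_mul]
    exact (two_rpow_le_abs_pow_sub_pow hb hmn).trans
      (le_mul_of_one_le_left (abs_nonneg _) (by exact_mod_cast Int.one_le_abs hh))
  calc ‖fourierMeasure μ (h * ((b : ℝ) ^ n - (b : ℝ) ^ m))‖
      ≤ C * |h * ((b : ℝ) ^ n - (b : ℝ) ^ m)| ^ (-σ) := hμ _ (abs_pos.1 (hpow.trans_le hfreq))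
    _ ≤ C * ((2 : ℝ) ^ (((m : ℝ) + n) / 2 - 1)) ^ (-σ) :=
        mul_le_mul_of_nonneg_left (Real.rpow_le_rpow_of_nonpos hpow hfreq (neg_nonpos.2 hσ)) hC
    _ = C * 2 ^ σ * (((2 : ℝ) ^ (-(σ / 2))) ^ m * ((2 : ℝ) ^ (-(σ / 2))) ^ n) := by
        rw [mul_assoc, ← Real.rpow_natCast, ← Real.rpow_natCast, ← Real.rpow_mul two_pos.le,
          ← Real.rpow_mul two_pos.le, ← Real.rpow_mul two_pos.le, ← Real.rpow_add two_pos,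
          ← Real.rpow_add two_pos]
        ring_nf

/-- The diagonal of the expanded square contributes `N`; off the diagonal the decay of the Fourier
transform along the lacunary frequencies leaves a product of two geometric series. -/
lemma exists_integral_norm_weylSum_sq_le {μ : Measure ℝ} [IsProbabilityMeasure μ] {C σ : ℝ}
    (hσ : 0 < σ) (hμ : ∀ ξ : ℝ, ξ ≠ 0 → ‖fourierMeasure μ ξ‖ ≤ C * |ξ| ^ (-σ)) {b : ℕ}
    (hb : 2 ≤ b) {h : ℤ} (hh : h ≠ 0) :
    ∃ D : ℝ, 0 ≤ D ∧ ∀ N : ℕ, ∫ x, ‖weylSum b h N x‖ ^ 2 ∂μ ≤ N + D := by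
  have hC : 0 ≤ C := by simpa using (norm_nonneg _).trans (hμ 1 one_ne_zero)
  set ρ : ℝ := (2 : ℝ) ^ (-(σ / 2))
  have hρ0 : 0 < ρ := by positivity
  have hρ1 : ρ < 1 := Real.rpow_lt_one_of_one_lt_of_neg one_lt_two (by linarith)
  refine ⟨C * 2 ^ σ * ((1 - ρ)⁻¹ * (1 - ρ)⁻¹), by have := sub_pos.2 hρ1; positivity, fun N => ?_⟩
  have hgeom : ∑ m ∈ Finset.range N, ρ ^ m ≤ (1 - ρ)⁻¹ := by
    rw [← tsum_geometric_of_lt_one hρ0.le hρ1]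
    exact (summable_geometric_of_lt_one hρ0.le hρ1).sum_le_tsum _ fun m _ => by positivity
  have hterm (m n : ℕ) : ‖fourierMeasure μ (h * ((b : ℝ) ^ n - (b : ℝ) ^ m))‖ ≤
      (if m = n then 1 else 0) + C * 2 ^ σ * (ρ ^ m * ρ ^ n) := by
    split_ifs with hmn
    · rw [hmn, show fourierMeasure μ (h * ((b : ℝ) ^ n - (b : ℝ) ^ n)) = 1 by simp [fourierMeasure],
        norm_one]
      exact le_add_of_nonneg_right (by positivity)
    · rw [zero_add]
      exact norm_fourierMeasure_mul_pow_sub_pow_le hσ.le hμ hb hh hmn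
  have hdiag : ∑ m ∈ Finset.range N, ∑ n ∈ Finset.range N, (if m = n then (1 : ℝ) else 0) = N := by
    simp +contextual [Finset.sum_ite_eq]
  calc ∫ x, ‖weylSum b h N x‖ ^ 2 ∂μ
      ≤ ‖((∫ x, ‖weylSum b h N x‖ ^ 2 ∂μ : ℝ) : ℂ)‖ :=
        (le_abs_self _).trans (Complex.norm_real _).ge
    _ ≤ ∑ m ∈ Finset.range N, ∑ n ∈ Finset.range N,
          ((if m = n then 1 else 0) + C * 2 ^ σ * (ρ ^ m * ρ ^ n)) := by
        rw [integral_norm_weylSum_sq]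
        exact norm_sum_le_of_le _ fun m _ => norm_sum_le_of_le _ fun n _ => hterm m n
    _ = N + C * 2 ^ σ * ((∑ m ∈ Finset.range N, ρ ^ m) * ∑ n ∈ Finset.range N, ρ ^ n) := by
        simp_rw [Finset.sum_add_distrib, hdiag, ← Finset.mul_sum, ← Finset.sum_mul]
    _ ≤ N + C * 2 ^ σ * ((1 - ρ)⁻¹ * (1 - ρ)⁻¹) := by gcongr

lemma ae_tendsto_zero_of_summable_integral {α : Type*} [MeasurableSpace α] {μ : Measure α}
    {X : ℕ → α → ℝ} (hX : ∀ k, Integrable (X k) μ) (hX0 : ∀ k x, 0 ≤ X k x) {v : ℕ → ℝ}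
    (hv : Summable v) (hXv : ∀ k, ∫ x, X k x ∂μ ≤ v k) :
    ∀ᵐ x ∂μ, Tendsto (fun k => X k x) atTop (𝓝 0) := by
  have hfin : ∫⁻ x, ∑' k, ENNReal.ofReal (X k x) ∂μ ≠ ⊤ := by
    rw [lintegral_tsum fun k => (hX k).aemeasurable.ennreal_ofReal]
    refine ne_top_of_le_ne_top hv.tsum_ofReal_ne_top (ENNReal.tsum_le_tsum fun k => ?_)
    rw [← ofReal_integral_eq_lintegral_ofReal (hX k) (Eventually.of_forall (hX0 k))]
    exact ENNReal.ofReal_le_ofReal (hXv k)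
  filter_upwards [ae_lt_top' (AEMeasurable.tsum fun k =>
    (hX k).aemeasurable.ennreal_ofReal) hfin] with x hx
  refine ((ENNReal.tendsto_toReal ENNReal.zero_ne_top).comp
    (ENNReal.tendsto_atTop_zero_of_tsum_ne_top hx.ne)).congr fun k => ?_
  exact ENNReal.toReal_ofReal (hX0 k x)

lemma norm_le_norm_sqrt_sq_add {S : ℕ → ℂ} (hS : ∀ M N : ℕ, M ≤ N → ‖S N - S M‖ ≤ N - M) (N : ℕ) :
    ‖S N‖ ≤ ‖S (N.sqrt ^ 2)‖ + 2 * N.sqrt := by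
  have hN : (N : ℝ) ≤ (N.sqrt ^ 2 : ℕ) + 2 * N.sqrt := by
    exact_mod_cast (show N ≤ N.sqrt ^ 2 + 2 * N.sqrt by linarith [N.sqrt_le_add, sq N.sqrt])
  have hlip := hS _ _ N.sqrt_le'
  have htri := norm_le_norm_add_norm_sub' (S N) (S (N.sqrt ^ 2))
  linarith

lemma tendsto_inv_mul_of_tendsto_squares {S : ℕ → ℂ}
    (hS : ∀ M N : ℕ, M ≤ N → ‖S N - S M‖ ≤ N - M)
    (h : Tendsto (fun k : ℕ => ‖S (k ^ 2)‖ ^ 2 / (k : ℝ) ^ 4) atTop (𝓝 0)) :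
    Tendsto (fun N : ℕ => (N : ℂ)⁻¹ * S N) atTop (𝓝 0) := by
  have hsquares : Tendsto (fun k : ℕ => ‖S (k ^ 2)‖ / (k : ℝ) ^ 2) atTop (𝓝 0) := by
    have hroot := (Real.continuous_sqrt.tendsto 0).comp h
    rw [Real.sqrt_zero] at hroot
    refine hroot.congr fun k => ?_
    rw [Function.comp, show (k : ℝ) ^ 4 = ((k : ℝ) ^ 2) ^ 2 by ring, ← div_pow,
      Real.sqrt_sq (by positivity)]
  have hbound : Tendsto (fun k : ℕ => ‖S (k ^ 2)‖ / (k : ℝ) ^ 2 + 2 / k) atTop (𝓝 0) := by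
    simpa using hsquares.add (tendsto_const_div_atTop_nhds_zero_nat 2)
  have hsqrt : Tendsto Nat.sqrt atTop atTop :=
    tendsto_atTop_atTop.2 fun k => ⟨k ^ 2, fun N hN => Nat.le_sqrt'.2 hN⟩
  rw [tendsto_zero_iff_norm_tendsto_zero]
  refine squeeze_zero' (Eventually.of_forall fun _ => norm_nonneg _) ?_ (hbound.comp hsqrt)
  filter_upwards [eventually_ge_atTop 1] with N hN
  have _ : (0 : ℝ) < N.sqrt := Nat.cast_pos.2 (Nat.sqrt_pos.2 hN)
  have hle : (N.sqrt : ℝ) ^ 2 ≤ N := by exact_mod_cast N.sqrt_le'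
  rw [norm_mul, norm_inv, Complex.norm_natCast]
  calc (N : ℝ)⁻¹ * ‖S N‖
      ≤ ((N.sqrt : ℝ) ^ 2)⁻¹ * (‖S (N.sqrt ^ 2)‖ + 2 * N.sqrt) := by
        gcongr
        exact norm_le_norm_sqrt_sq_add hS N
    _ = ‖S (N.sqrt ^ 2)‖ / (N.sqrt : ℝ) ^ 2 + 2 / N.sqrt := by field_simp

lemma ae_tendsto_norm_weylSum_sq {μ : Measure ℝ} [IsProbabilityMeasure μ] {C σ : ℝ} (hσ : 0 < σ)
    (hμ : ∀ ξ : ℝ, ξ ≠ 0 → ‖fourierMeasure μ ξ‖ ≤ C * |ξ| ^ (-σ)) {b : ℕ} (hb : 2 ≤ b) {h : ℤ}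
    (hh : h ≠ 0) :
    ∀ᵐ x ∂μ, Tendsto (fun k : ℕ => ‖weylSum b h (k ^ 2) x‖ ^ 2 / (k : ℝ) ^ 4) atTop (𝓝 0) := by
  obtain ⟨D, hD, hDN⟩ := exists_integral_norm_weylSum_sq_le hσ hμ hb hh
  refine ae_tendsto_zero_of_summable_integral (v := fun k : ℕ => (1 + D) * (1 / (k : ℝ) ^ 2))
    (fun k => ?_) (fun k x => by positivity)
    ((Real.summable_one_div_nat_pow.2 one_lt_two).mul_left _) (fun k => ?_)
  · have hbound (x : ℝ) : ‖‖weylSum b h (k ^ 2) x‖ ^ 2‖ ≤ ((k ^ 2 : ℕ) : ℝ) ^ 2 := by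
      rw [norm_pow, norm_norm]
      gcongr
      exact norm_weylSum_le b h (k ^ 2) x
    exact (Integrable.of_bound ((continuous_weylSum b h (k ^ 2)).norm.pow 2).aestronglyMeasurable
      _ (Eventually.of_forall hbound)).div_const _
  · rcases k.eq_zero_or_pos with rfl | hk
    · simp
    have hk1 : (1 : ℝ) ≤ (k : ℝ) ^ 2 := one_le_pow₀ (Nat.one_le_cast.2 hk)
    rw [integral_div, div_le_iff₀ (by positivity)]
    calc ∫ x, ‖weylSum b h (k ^ 2) x‖ ^ 2 ∂μ ≤ (k : ℝ) ^ 2 + D := by exact_mod_cast hDN (k ^ 2)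
      _ ≤ (1 + D) * (k : ℝ) ^ 2 := by nlinarith
      _ = (1 + D) * (1 / (k : ℝ) ^ 2) * (k : ℝ) ^ 4 := by field_simp

theorem ae_isNormalNumber {μ : Measure ℝ} [IsProbabilityMeasure μ] {C σ : ℝ} (hσ : 0 < σ)
    (hμ : ∀ ξ : ℝ, ξ ≠ 0 → ‖fourierMeasure μ ξ‖ ≤ C * |ξ| ^ (-σ)) :
    ∀ᵐ x ∂μ, IsNormalNumber x := by
  have hsquares : ∀ᵐ x ∂μ, ∀ (b : ℕ) (h : ℤ), 2 ≤ b → h ≠ 0 →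
      Tendsto (fun k : ℕ => ‖weylSum b h (k ^ 2) x‖ ^ 2 / (k : ℝ) ^ 4) atTop (𝓝 0) := by
    simp only [ae_all_iff, Filter.eventually_imp_distrib_left]
    exact fun b h hb hh => ae_tendsto_norm_weylSum_sq hσ hμ hb hh
  filter_upwards [hsquares] with x hx b hb
  exact equidistributedModOne_of_weyl fun h hh => tendsto_inv_mul_of_tendsto_squares
    (fun M N hMN => norm_weylSum_sub_le b h hMN x) (hx b h hb hh)

/-! ### Blocks of primes -/

/-- A block of primes at scale `M`: at least `M ^ (1 - ε)` primes, all of them between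
`M ^ (1 - ε)` and `M`. -/
structure IsPrimeBlock (ε M : ℝ) (P : Finset ℕ) : Prop where
  prime : ∀ q ∈ P, q.Prime
  rpow_le : ∀ q ∈ P, M ^ (1 - ε) ≤ q
  le_scale : ∀ q ∈ P, (q : ℝ) ≤ M
  rpow_le_card : M ^ (1 - ε) ≤ P.card

lemma eventually_rpow_le_primeCounting {ε : ℝ} (hε : 0 < ε) (hε1 : ε ≤ 1) :
    ∀ᶠ M : ℝ in atTop, 2 * M ^ (1 - ε) + 1 ≤ Nat.primeCounting ⌊M⌋₊ := by
  have hlog := (isLittleO_log_rpow_atTop (half_pos hε)).bound one_pos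
  have hbig := (tendsto_rpow_atTop (half_pos hε)).eventually_ge_atTop 14
  filter_upwards [hlog, hbig, eventually_ge_atTop 2] with M hlogM hM14 hM2
  have hM0 : 0 < M := by linarith
  have hM1 : 1 ≤ M := by linarith
  have hlogM0 : 0 < Real.log M := Real.log_pos (by linarith)
  rw [one_mul, Real.norm_of_nonneg hlogM0.le, Real.norm_of_nonneg (by positivity)] at hlogM
  have hY1 : 1 ≤ M ^ (1 - ε) := Real.one_le_rpow hM1 (by linarith)
  have hle : M ^ (ε / 2) ≤ M ^ (1 - ε / 2) :=
    Real.rpow_le_rpow_of_exponent_le hM1 (by linarith)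
  have hleft : (2 * M ^ (1 - ε) + 1) * Real.log M ≤ 3 * M ^ (1 - ε / 2) := by
    calc (2 * M ^ (1 - ε) + 1) * Real.log M ≤ (3 * M ^ (1 - ε)) * M ^ (ε / 2) := by
          gcongr
          linarith
      _ = 3 * M ^ (1 - ε / 2) := by rw [mul_assoc, ← Real.rpow_add hM0]; ring_nf
  have hright : 14 * M ^ (1 - ε / 2) ≤ M := by
    calc 14 * M ^ (1 - ε / 2) ≤ M ^ (ε / 2) * M ^ (1 - ε / 2) := by gcongr
      _ = M := by rw [← Real.rpow_add hM0, add_sub_cancel, Real.rpow_one]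
  have hlog2 : Real.log (M + 2) ≤ 2 * Real.log M := by
    rw [← Nat.cast_ofNat (R := ℝ), ← Real.log_pow]
    exact Real.log_le_log (by positivity) (by push_cast; nlinarith)
  refine le_trans ?_ (Chebyshev.pi_ge' (x := M) (by linarith))
  rw [le_div_iff₀ hlogM0]
  nlinarith [Real.log_two_gt_d9, Real.log_two_lt_d9]

lemma primeCounting_le_card_filter_add_ceil (N : ℕ) (Y : ℝ) :
    Nat.primeCounting N ≤
      ((Finset.range (N + 1)).filter fun q : ℕ => q.Prime ∧ Y ≤ q).card + ⌈Y⌉₊ := by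
  rw [Nat.primeCounting, Nat.primeCounting', Nat.count_eq_card_filter_range]
  calc ((Finset.range (N + 1)).filter Nat.Prime).card
      ≤ (((Finset.range (N + 1)).filter fun q : ℕ => q.Prime ∧ Y ≤ q) ∪
          Finset.range ⌈Y⌉₊).card := by
        refine Finset.card_le_card fun q hq => ?_
        simp only [Finset.mem_union, Finset.mem_filter, Finset.mem_range (n := ⌈Y⌉₊),
          Nat.lt_ceil] at hq ⊢
        exact (le_or_gt Y q).imp (fun h => ⟨hq.1, hq.2, h⟩) id
    _ ≤ _ := (Finset.card_union_le _ _).trans_eq (by rw [Finset.card_range])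

lemma eventually_exists_isPrimeBlock {ε : ℝ} (hε : 0 < ε) (hε1 : ε ≤ 1) :
    ∀ᶠ M : ℝ in atTop, ∃ P : Finset ℕ, IsPrimeBlock ε M P := by
  filter_upwards [eventually_rpow_le_primeCounting hε hε1, eventually_ge_atTop 0] with M hcount hM
  refine ⟨(Finset.range (⌊M⌋₊ + 1)).filter fun q => q.Prime ∧ M ^ (1 - ε) ≤ q,
    fun q hq => (Finset.mem_filter.1 hq).2.1, fun q hq => (Finset.mem_filter.1 hq).2.2,
    fun q hq => ?_, ?_⟩
  · exact (Nat.le_floor_iff hM).1 (Finset.mem_range_succ_iff.1 (Finset.mem_filter.1 hq).1)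
  · have hcard : (Nat.primeCounting ⌊M⌋₊ : ℝ) ≤ _ :=
      Nat.cast_le.2 (primeCounting_le_card_filter_add_ceil ⌊M⌋₊ (M ^ (1 - ε)))
    rw [Nat.cast_add] at hcard
    linarith [Nat.ceil_lt_add_one (Real.rpow_nonneg hM (1 - ε))]

lemma eventually_exists_isPrimeBlock_forall {ε : ℝ} (hε : 0 < ε) (hε1 : ε < 1) {p : ℕ → Prop}
    (hp : ∀ᶠ q in atTop, p q) :
    ∀ᶠ M : ℝ in atTop, ∃ P : Finset ℕ, IsPrimeBlock ε M P ∧ ∀ q ∈ P, p q := by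
  obtain ⟨q₀, hq₀⟩ := eventually_atTop.1 hp
  filter_upwards [eventually_exists_isPrimeBlock hε hε1.le,
    (tendsto_rpow_atTop (sub_pos.2 hε1)).eventually_ge_atTop (q₀ : ℝ)] with M ⟨P, hP⟩ hM
  exact ⟨P, hP, fun q hq => hq₀ q (Nat.cast_le.1 (hM.trans (hP.rpow_le q hq)))⟩

namespace IsPrimeBlock

variable {ε M : ℝ} {P : Finset ℕ}

lemma card_pos (hP : IsPrimeBlock ε M P) (hM : 0 < M) : 0 < P.card :=
  Nat.cast_pos.1 ((Real.rpow_pos_of_pos hM _).trans_le hP.rpow_le_card)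

lemma isFlatKernel {C s θ : ℝ} {φ : ℝ → ℝ} {a δ : ℕ → ℝ} (hP : IsPrimeBlock ε M P)
    (hφ : ContDiff ℝ ∞ φ) (hφc : HasCompactSupport φ) (hφ0 : ∀ x, 0 ≤ φ x) (hφ1 : ∫ x, φ x = 1)
    (hφC : ∀ ξ, ‖𝓕 (fun x => (φ x : ℂ)) ξ‖ ≤ C * (1 + |ξ|) ^ (-3 : ℝ)) (hε : ε < 1) (hM : 1 ≤ M)
    (hexp : Real.exp 1 ≤ M ^ (1 - ε)) (hs : 0 ≤ s) (hδ : ∀ q ∈ P, (q : ℝ) ^ (-s) ≤ δ q) :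
    IsFlatKernel (averageKernel φ θ P a δ) (averageCoeff φ θ P a δ)
      (C * (1 + s / (1 - ε)) / P.card) (M ^ s) := by
  have hM0 : 0 < M := by linarith
  have hε' : 0 < 1 - ε := by linarith
  refine isFlatKernel_averageKernel hφ hφc hφ0 hφ1 hφC (Finset.card_pos.1 (hP.card_pos hM0))
    (fun q hq => ⟨hP.prime q hq, hP.rpow_le q hq⟩) hexp (Real.one_le_rpow hM hs) (by positivity)
    ?_ fun q hq => le_trans ?_ (hδ q hq)
  · rw [Real.log_rpow hM0, Real.log_rpow hM0, ← mul_assoc, div_mul_cancel₀ _ hε'.ne']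
  · rw [← Real.rpow_neg hM0.le]
    exact Real.rpow_le_rpow_of_nonpos (Nat.cast_pos.2 (hP.prime q hq).pos) (hP.le_scale q hq)
      (by linarith)

end IsPrimeBlock

/-! ### The scales of the construction -/

/-- The scales of the construction: each is the `ρ`-th power of the preceding one. -/
noncomputable def scale (X ρ : ℝ) (k : ℕ) : ℝ := X ^ (ρ ^ k)

section Scale

variable {X ρ : ℝ}

lemma scale_succ (hX : 0 ≤ X) (ρ : ℝ) (k : ℕ) : scale X ρ (k + 1) = scale X ρ k ^ ρ := by
  rw [scale, scale, ← Real.rpow_mul hX, pow_succ]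

lemma le_scale (hX : 1 ≤ X) (hρ : 1 ≤ ρ) (k : ℕ) : X ≤ scale X ρ k := by
  calc X = X ^ (1 : ℝ) := (Real.rpow_one X).symm
    _ ≤ scale X ρ k := Real.rpow_le_rpow_of_exponent_le hX (one_le_pow₀ hρ)

lemma monotone_scale (hX : 1 ≤ X) (hρ : 1 ≤ ρ) : Monotone (scale X ρ) :=
  fun _ _ h => Real.rpow_le_rpow_of_exponent_le hX (pow_le_pow_right₀ hρ h)

lemma tendsto_scale (hX : 1 < X) (hρ : 1 < ρ) : Tendsto (scale X ρ) atTop atTop :=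
  (tendsto_rpow_atTop_of_base_gt_one X hX).comp (tendsto_pow_atTop_atTop_of_one_lt hρ)

lemma scale_succ_rpow_le {E : ℝ} (hX : 1 ≤ X) (hρ : 1 < ρ) (hE : E < 0)
    (hXE : X ^ (E * (ρ - 1)) ≤ 1 / 2) (k : ℕ) : scale X ρ (k + 1) ^ E ≤ X ^ E * (1 / 2) ^ k := by
  have hX0 : 0 < X := by linarith
  have hbernoulli : 1 + (k + 1 : ℕ) * (ρ - 1) ≤ ρ ^ (k + 1) :=
    one_add_mul_sub_le_pow (by linarith) _
  rw [Nat.cast_succ] at hbernoulli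
  calc scale X ρ (k + 1) ^ E = X ^ (ρ ^ (k + 1) * E) := by rw [scale, ← Real.rpow_mul hX0.le]
    _ ≤ X ^ (E + E * (ρ - 1) * k) := Real.rpow_le_rpow_of_exponent_le hX (by nlinarith)
    _ = X ^ E * (X ^ (E * (ρ - 1))) ^ k := by
        rw [Real.rpow_add hX0, Real.rpow_mul hX0.le, Real.rpow_natCast]
    _ ≤ X ^ E * (1 / 2) ^ k := by gcongr

lemma exists_scale {E : ℝ} (hρ : 1 < ρ) (hE : E < 0) (D : ℝ) {R : ℝ → Prop}
    (hR : ∀ᶠ M in atTop, R M) :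
    ∃ X, 1 < X ∧ (∀ k, R (scale X ρ k)) ∧ ∀ k, D * scale X ρ (k + 1) ^ E ≤ (1 / 2) ^ k := by
  have htendsto {e : ℝ} (he : e < 0) : Tendsto (fun X : ℝ => X ^ e) atTop (𝓝 0) := by
    simpa only [neg_neg] using tendsto_rpow_neg_atTop (neg_pos.2 he)
  have hD : Tendsto (fun X : ℝ => |D| * X ^ E) atTop (𝓝 0) := by
    simpa only [mul_zero] using (htendsto hE).const_mul |D|
  obtain ⟨X₀, hX₀⟩ := eventually_atTop.1 hR
  obtain ⟨X, hX₀X, hX1, hXD, hXE⟩ := ((eventually_ge_atTop X₀).and ((eventually_gt_atTop 1).and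
    ((hD.eventually_le_const one_pos).and
      ((htendsto (mul_neg_of_neg_of_pos hE (sub_pos.2 hρ))).eventually_le_const
        (one_half_pos (α := ℝ)))))).exists
  refine ⟨X, hX1, fun k => hX₀ _ (hX₀X.trans (le_scale hX1.le hρ.le k)), fun k => ?_⟩
  have hM := scale_succ_rpow_le hX1.le hρ hE hXE k
  calc D * scale X ρ (k + 1) ^ E ≤ |D| * (X ^ E * (1 / 2) ^ k) :=
        mul_le_mul (le_abs_self D) hM (Real.rpow_nonneg (Real.rpow_nonneg (by linarith) _) _)
          (abs_nonneg D)
    _ ≤ 1 * (1 / 2) ^ k := by rw [← mul_assoc]; gcongr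
    _ = (1 / 2) ^ k := one_mul _

/-- Since `scale X ρ k = scale X ρ (k + 1) ^ ρ⁻¹`, everything is a power of the later scale. -/
lemma div_card_mul_scale_rpow_le {ε s σ A : ℝ} {P : Finset ℕ} {k : ℕ} (hX : 0 < X) (hρ : ρ ≠ 0)
    (hA : 0 ≤ A) (hP : IsPrimeBlock ε (scale X ρ (k + 1)) P) :
    A / P.card * (scale X ρ k ^ s) ^ (1 + ε - σ) * (scale X ρ (k + 1) ^ s) ^ σ ≤
      A * scale X ρ (k + 1) ^ (-(1 - ε) + s * (1 + ε - σ) / ρ + s * σ) := by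
  have hM0 (k : ℕ) : 0 < scale X ρ k := Real.rpow_pos_of_pos hX _
  have hprev : scale X ρ k = scale X ρ (k + 1) ^ ρ⁻¹ := by
    rw [scale_succ hX.le, Real.rpow_rpow_inv (hM0 k).le hρ]
  have := Real.rpow_pos_of_pos (hM0 (k + 1)) (1 - ε)
  calc A / P.card * (scale X ρ k ^ s) ^ (1 + ε - σ) * (scale X ρ (k + 1) ^ s) ^ σ
      ≤ A / scale X ρ (k + 1) ^ (1 - ε) * (scale X ρ k ^ s) ^ (1 + ε - σ) *
          (scale X ρ (k + 1) ^ s) ^ σ := by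
        have := hM0 k
        have := hM0 (k + 1)
        gcongr
        exact hP.rpow_le_card
    _ = A * (scale X ρ (k + 1) ^ (-(1 - ε)) * scale X ρ (k + 1) ^ (ρ⁻¹ * s * (1 + ε - σ)) *
          scale X ρ (k + 1) ^ (s * σ)) := by
        rw [hprev, ← Real.rpow_mul (hM0 _).le, ← Real.rpow_mul (hM0 _).le,
          ← Real.rpow_mul (hM0 _).le, Real.rpow_neg (hM0 _).le]
        ring
    _ = A * scale X ρ (k + 1) ^ (-(1 - ε) + s * (1 + ε - σ) / ρ + s * σ) := by
        rw [← Real.rpow_add (hM0 _), ← Real.rpow_add (hM0 _)]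
        ring_nf

end Scale

/-! ### A measure near shifted fractions with prime denominators -/

/-- The numbers within `δ q` of a point `(r - θ) / q + a q` with `q ∈ P`. -/
def nearSet (θ : ℝ) (a δ : ℕ → ℝ) (P : Finset ℕ) : Set ℝ :=
  {x | ∃ q ∈ P, ∃ r : ℤ, |x - ((r : ℝ) - θ) / q - a q| ≤ δ q}

lemma isClosed_nearSet (θ : ℝ) (a δ : ℕ → ℝ) {P : Finset ℕ} (hP : ∀ q ∈ P, 0 < q) :
    IsClosed (nearSet θ a δ P) := by
  have hunion : nearSet θ a δ P =
      ⋃ q ∈ P, {x : ℝ | ∃ r : ℤ, |x - ((r : ℝ) - θ) / q - a q| ≤ δ q} := by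
    ext x
    simp [nearSet]
  rw [hunion]
  exact P.finite_toSet.isClosed_biUnion fun q hq => isClosed_setOf_exists_int_near θ (hP q hq) _ _

lemma averageKernel_eq_zero_of_notMem_nearSet {φ : ℝ → ℝ} {θ : ℝ} {a δ : ℕ → ℝ} {P : Finset ℕ}
    (hφ : ∀ x ∉ Metric.closedBall 0 1, φ x = 0) (hP : ∀ q ∈ P, 0 < q) (hδ : ∀ q ∈ P, 0 < δ q)
    {x : ℝ} (hx : x ∉ nearSet θ a δ P) : averageKernel φ θ P a δ x = 0 := by
  by_contra hne
  exact hx (exists_int_of_averageKernel_ne_zero (fun z hz => hφ z (by simpa using hz)) hP hδ hne)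

theorem exists_measure_nearSet {ε ρ s σ : ℝ} (hε : 0 < ε) (hε1 : ε < 1) (hρ : 1 < ρ) (hs : 0 ≤ s)
    (hσ : 0 ≤ σ) (hσ1 : σ ≤ 1) (hE : -(1 - ε) + s * (1 + ε - σ) / ρ + s * σ < 0) (θ : ℝ)
    {a δ : ℕ → ℝ} (hδ : ∀ᶠ q : ℕ in atTop, (q : ℝ) ^ (-s) ≤ δ q) {p : ℕ → Prop}
    (hp : ∀ᶠ q in atTop, p q) (y : ℝ) {t : ℝ} (ht : 0 < t) :
    ∃ (X : ℝ) (P : ℕ → Finset ℕ) (μ : Measure ℝ), 1 < X ∧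
      (∀ k, IsPrimeBlock ε (scale X ρ (k + 1)) (P k) ∧ ∀ q ∈ P k, p q) ∧
      IsProbabilityMeasure μ ∧ μ (Metric.closedBall y t)ᶜ = 0 ∧
      (∀ k, μ (nearSet θ a δ (P k))ᶜ = 0) ∧
      ∃ C, ∀ ξ, ‖fourierMeasure μ ξ‖ ≤ C * (1 + |ξ|) ^ (-σ) := by
  obtain ⟨φ, C, hφ, hφc, hφ0, hφt, hφ1, hC0, hC⟩ := exists_smooth_bump y ht 2
  obtain ⟨χ, C', hχ, hχc, hχ0, hχt, hχ1, hC'0, hC'⟩ := exists_smooth_bump 0 one_pos 3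
  have hlattice := latticeBound_pos (p := 1 + ε) (by linarith)
  set A := C' * (1 + s / (1 - ε))
  have hA : 0 ≤ A := mul_nonneg hC'0 (by have := sub_pos.2 hε1; positivity)
  obtain ⟨X, hX, hblock, hsmall⟩ := exists_scale hρ hE (64 * latticeBound (1 + ε) * C * A)
    (((tendsto_rpow_atTop (sub_pos.2 hε1)).eventually_ge_atTop (Real.exp 1)).and
      (eventually_exists_isPrimeBlock_forall hε hε1 (hδ.and hp)))
  choose hexp P hP hPδ using fun k => hblock (k + 1)
  have hM (k : ℕ) : 1 ≤ scale X ρ k := hX.le.trans (le_scale hX.le hρ.le k)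
  have hpos (k : ℕ) : ∀ q ∈ P k, 0 < q := fun q hq => ((hP k).prime q hq).pos
  have hscheme : IsProductScheme σ (1 + ε) C φ (fun k => averageKernel χ θ (P k) a δ)
      (fun k => averageCoeff χ θ (P k) a δ) (fun k => A / (P k).card)
      (fun k => scale X ρ k ^ s) := by
    refine ⟨hσ, by linarith, by linarith, by linarith, hφ.continuous, hφc, hφ0, hφ1,
      by exact_mod_cast hC, Real.one_le_rpow (hM 0) hs, fun i j hij => ?_, fun k => ?_,
      fun k => ?_⟩
    · exact Real.rpow_le_rpow (by linarith [hM i]) (monotone_scale hX.le hρ.le hij) hs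
    · exact (hP k).isFlatKernel hχ hχc hχ0 hχ1 (by exact_mod_cast hC') hε1 (hM _) (hexp k) hs
        fun q hq => (hPδ k q hq).1
    · refine (mul_le_mul_of_nonneg_left (div_card_mul_scale_rpow_le (by linarith) (by linarith) hA
        (hP k)) (by positivity)).trans ?_
      rw [← mul_assoc]
      exact hsmall k
  obtain ⟨μ, hμ, hμK, hμZ, hdecay⟩ := hscheme.exists_measure (isCompact_closedBall y t) hφt
    (fun k => isClosed_nearSet θ a δ (hpos k)) fun k x hx =>
      averageKernel_eq_zero_of_notMem_nearSet hχt (hpos k) (fun q hq =>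
        (Real.rpow_pos_of_pos (Nat.cast_pos.2 (hpos k q hq)) _).trans_le (hPδ k q hq).1) hx
  exact ⟨X, P, μ, hX, fun k => ⟨hP k, fun q hq => (hPδ k q hq).2⟩, hμ, hμK, hμZ, _, hdecay⟩

/-! ### The measure lives on `Exact ψ θ` -/

lemma isCoprime_of_near {θ x : ℝ} (hx : x ∈ Metric.closedBall (1 / 2 : ℝ) (1 / 4)) {q : ℕ}
    (hq : q.Prime) (hqθ : 4 * (1 + |θ|) < q) {r : ℤ} (hr : |x - ((r : ℝ) - θ) / q| ≤ (q : ℝ)⁻¹) :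
    IsCoprime r (q : ℤ) := by
  rw [isCoprime_comm, Prime.coprime_iff_not_dvd (Nat.prime_iff_prime_int.1 hq)]
  -- If `q ∣ r`, then `(r - θ) / q` is so close to an integer that `x` would be near it as well.
  rintro ⟨m, rfl⟩
  have hq0 : (0 : ℝ) < q := Nat.cast_pos.2 hq.pos
  have hsplit : x - (((q * m : ℤ) : ℝ) - θ) / q = x - m + θ / q := by
    push_cast
    field_simp
    ring
  have hnear : |x - m| < 1 / 4 := by
    calc |x - m| = |(x - m + θ / q) - θ / q| := by rw [add_sub_cancel_right]
      _ ≤ |x - m + θ / q| + |θ / q| := abs_sub _ _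
      _ ≤ (q : ℝ)⁻¹ + |θ| / q := by
          rw [abs_div, Nat.abs_cast]
          exact add_le_add_left (hsplit ▸ hr) _
      _ = (1 + |θ|) / q := by ring
      _ < 1 / 4 := by rw [div_lt_iff₀ hq0]; linarith
  rw [Metric.mem_closedBall, Real.dist_eq, abs_le] at hx
  rw [abs_lt] at hnear
  have hm0 : (0 : ℝ) < m := by linarith
  have hm1 : (m : ℝ) < 1 := by linarith
  exact (Int.cast_pos.1 hm0).not_ge (Int.lt_add_one_iff.1 (by exact_mod_cast hm1))

lemma eventually_rpow_neg_le_half_rpow_mul {ψ : ℕ → ℝ} {τ ε : ℝ} (h : HasOrder ψ τ)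
    (hψ : ∀ q : ℕ, 1 ≤ q → 0 < ψ q) (hε : 0 < ε) :
    ∀ᶠ q : ℕ in atTop, (q : ℝ) ^ (-(τ + 2 * ε)) ≤ (q : ℝ) ^ (-ε) / 2 * ψ q := by
  have htwo : ∀ᶠ q : ℕ in atTop, 2 ≤ (q : ℝ) ^ (ε / 2) :=
    ((tendsto_rpow_atTop (half_pos hε)).comp tendsto_natCast_atTop_atTop).eventually_ge_atTop 2
  filter_upwards [h.eventually_ge hψ (show τ < τ + ε / 2 by linarith), htwo,
    eventually_ge_atTop 1] with q hψq hq2 hq1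
  have hq0 : (0 : ℝ) < q := Nat.cast_pos.2 hq1
  calc (q : ℝ) ^ (-(τ + 2 * ε))
      = (q : ℝ) ^ (-(3 / 2 * ε)) * (q : ℝ) ^ (-(τ + ε / 2)) := by
        rw [← Real.rpow_add hq0]; ring_nf
    _ ≤ (q : ℝ) ^ (-(3 / 2 * ε)) * ((q : ℝ) ^ (ε / 2) / 2) * ψ q := by
        gcongr
        exact le_mul_of_one_le_right (by positivity) (by linarith)
    _ = (q : ℝ) ^ (-ε) / 2 * ψ q := by
        rw [← mul_div_assoc, ← Real.rpow_add hq0]; ring_nf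

lemma bounds_of_abs_sub_le {e y w : ℝ} (he1 : e ≤ 1) (hw : 0 ≤ w)
    (h : |y - (1 - e / 2) * w| ≤ e / 2 * w) : (1 - e) * w ≤ y ∧ |y| ≤ w := by
  obtain ⟨hlow, hup⟩ := abs_le.1 h
  have := mul_nonneg (sub_nonneg.2 he1) hw
  exact ⟨by linarith, abs_le.2 ⟨by linarith, by linarith⟩⟩

lemma mem_Exact_of_mem_nearSet {θ g c τ' b ε X x : ℝ} {ψ : ℕ → ℝ} (hg : 0 < g) (hc : 0 < c)
    (hsep : Separated θ g c) (hψ_pos : ∀ q : ℕ, 1 ≤ q → 0 < ψ q)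
    (hψ : ∀ᶠ q : ℕ in atTop, ψ q ≤ (q : ℝ) ^ (-τ')) (hτ' : 1 < τ')
    (hb0 : 0 ≤ b) (hb : b < ((τ' - 1) / g) ^ 2) (hε : 0 < ε) (hε1 : ε < 1)
    (hρ : 1 < (1 - ε) * b) (hX : 1 < X) {P : ℕ → Finset ℕ}
    (hP : ∀ k, IsPrimeBlock ε (scale X ((1 - ε) * b) (k + 1)) (P k))
    (hPψ : ∀ k, ∀ q ∈ P k, 4 * (1 + |θ|) < q ∧ ψ q ≤ (q : ℝ)⁻¹)
    (hx : x ∈ Metric.closedBall (1 / 2 : ℝ) (1 / 4))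
    (hxP : ∀ k, x ∈ nearSet θ (fun q => (1 - (q : ℝ) ^ (-ε) / 2) * ψ q)
      (fun q => (q : ℝ) ^ (-ε) / 2 * ψ q) (P k)) :
    x ∈ Exact ψ θ := by
  choose q hqP r hr using hxP
  have hprime (k : ℕ) : (q k).Prime := (hP k).prime _ (hqP k)
  have hqR : Tendsto (fun k => (q k : ℝ)) atTop atTop :=
    tendsto_atTop_mono (fun k => (hP k).rpow_le _ (hqP k))
      ((tendsto_rpow_atTop (sub_pos.2 hε1)).comp
        ((tendsto_add_atTop_iff_nat 1).2 (tendsto_scale hX hρ)))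
  have hbounds (k : ℕ) := bounds_of_abs_sub_le (Real.rpow_le_one_of_one_le_of_nonpos
    (Nat.one_le_cast.2 (hprime k).pos) (neg_nonpos.2 hε.le)) (hψ_pos _ (hprime k).pos).le (hr k)
  refine mem_Exact_of_sequence hg hc hsep hψ_pos hψ hτ' hb (fun k => (hprime k).pos)
    (tendsto_natCast_atTop_iff.1 hqR) (fun k => ?_) (fun k => ?_)
    ((tendsto_rpow_neg_atTop hε).comp hqR) (fun k => (hbounds k).1) fun k => (hbounds k).2
  · have hM : 0 < scale X ((1 - ε) * b) (k + 1) := Real.rpow_pos_of_pos (by linarith) _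
    calc (q (k + 1) : ℝ) ≤ scale X ((1 - ε) * b) (k + 1 + 1) := (hP _).le_scale _ (hqP _)
      _ = (scale X ((1 - ε) * b) (k + 1) ^ (1 - ε)) ^ b := by
          rw [scale_succ (by linarith), Real.rpow_mul hM.le]
      _ ≤ (q k : ℝ) ^ b := by
          gcongr
          exact (hP k).rpow_le _ (hqP k)
  · obtain ⟨hqθ, hψq⟩ := hPψ k _ (hqP k)
    exact isCoprime_of_near hx (hprime k) hqθ ((hbounds k).2.trans hψq)

/-! ### The Fourier dimension of `Exact ψ θ` -/

lemma exists_separated_of_lt {θ γ τ b : ℝ}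
    (hγ : (θ = 0 ∧ γ = 1) ∨ (Irrational θ ∧ HasDiophantineExponent θ γ)) (hγ0 : 0 < γ)
    (hτ : 1 < τ) (hb : b < (γ ^ 2)⁻¹ * (τ - 1) ^ 2) :
    ∃ g c τ' : ℝ, 0 < g ∧ 0 < c ∧ 1 < τ' ∧ τ' < τ ∧ Separated θ g c ∧
      b < ((τ' - 1) / g) ^ 2 := by
  have hcont : ContinuousAt (fun ε : ℝ => ((τ - ε - 1) / (γ + ε)) ^ 2) 0 :=
    (ContinuousAt.div (by fun_prop) (by fun_prop) (by simpa using hγ0.ne')).pow 2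
  have hnear : ∀ᶠ ε : ℝ in 𝓝[>] 0, b < ((τ - ε - 1) / (γ + ε)) ^ 2 := by
    refine (hcont.eventually (lt_mem_nhds ?_)).filter_mono nhdsWithin_le_nhds
    beta_reduce
    rwa [sub_zero, add_zero, div_pow, div_eq_inv_mul]
  obtain ⟨ε, hbε, hε0, hε1⟩ := (hnear.and (Ioo_mem_nhdsGT (sub_pos.2 hτ))).exists
  obtain ⟨g, c, hg1, hgε, hc, hsep⟩ := exists_separated hγ hε0
  have hτε : 0 < τ - ε - 1 := by linarith
  have hg : 0 < g := by linarith
  exact ⟨g, c, τ - ε, hg, hc, by linarith, by linarith, hsep, hbε.trans_le (by gcongr)⟩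

lemma exists_small_parameter {τ β σ : ℝ} (hβ : 1 < β) (h : σ * τ * (β - 1) < β - τ) :
    ∃ ε : ℝ, 0 < ε ∧ ε < 1 ∧ 1 < (1 - ε) * ((1 - ε) * β) ∧
      -(1 - ε) + (τ + 2 * ε) * (1 + ε - σ) / ((1 - ε) * ((1 - ε) * β)) + (τ + 2 * ε) * σ < 0 := by
  have hβ0 : 0 < β := by linarith
  have hcont : ContinuousAt (fun ε : ℝ => -(1 - ε) +
      (τ + 2 * ε) * (1 + ε - σ) / ((1 - ε) * ((1 - ε) * β)) + (τ + 2 * ε) * σ) 0 :=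
    ContinuousAt.add (ContinuousAt.add (by fun_prop)
      (ContinuousAt.div (by fun_prop) (by fun_prop) (by simpa using hβ0.ne'))) (by fun_prop)
  have hneg : -(1 - (0 : ℝ)) + (τ + 2 * 0) * (1 + 0 - σ) / ((1 - 0) * ((1 - 0) * β)) +
      (τ + 2 * 0) * σ < 0 := by
    calc _ = (σ * τ * (β - 1) - (β - τ)) / β := by field_simp; ring
      _ < 0 := div_neg_of_neg_of_pos (sub_neg.2 h) hβ0
  have hscale : ∀ᶠ ε : ℝ in 𝓝 0, 1 < (1 - ε) * ((1 - ε) * β) :=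
    Tendsto.eventually_const_lt (by simpa using hβ)
      (show ContinuousAt (fun ε : ℝ => (1 - ε) * ((1 - ε) * β)) 0 by fun_prop)
  obtain ⟨ε, ⟨hερ, hεE⟩, hε0, hε1⟩ := ((hscale.and (hcont.eventually_lt_const
    hneg)).filter_mono nhdsWithin_le_nhds |>.and (Ioo_mem_nhdsGT one_pos)).exists
  exact ⟨ε, hε0, hε1, hερ, hεE⟩

theorem supportsFourierDecay_Exact {θ γ τ β s : ℝ} {ψ : ℕ → ℝ}
    (hγ : (θ = 0 ∧ γ = 1) ∨ (Irrational θ ∧ HasDiophantineExponent θ γ)) (hγ0 : 0 < γ)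
    (hψ_pos : ∀ q : ℕ, 1 ≤ q → 0 < ψ q) (hψ_order : HasOrder ψ τ) (hτ : 1 < τ)
    (hβ : β = (γ ^ 2)⁻¹ * (τ - 1) ^ 2) (hβ1 : 1 < β) (hs0 : 0 ≤ s) (hs2 : s ≤ 2)
    (hs : s * (τ * (β - 1)) < 2 * (β - τ)) :
    SupportsFourierDecay (Exact ψ θ) s := by
  obtain ⟨ε, hε0, hε1, hρ, hE⟩ := exists_small_parameter (τ := τ) (σ := s / 2) hβ1
    (by linarith)
  have hb : (1 - ε) * β < (γ ^ 2)⁻¹ * (τ - 1) ^ 2 := hβ ▸ by nlinarith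
  obtain ⟨g, c, τ', hg, hc, hτ'1, hτ', hsep, hbg⟩ := exists_separated_of_lt hγ hγ0 hτ hb
  have hlarge : ∀ᶠ q : ℕ in atTop, 4 * (1 + |θ|) < q ∧ ψ q ≤ (q : ℝ)⁻¹ := by
    filter_upwards [tendsto_natCast_atTop_atTop.eventually_gt_atTop (4 * (1 + |θ|)),
      hψ_order.eventually_le hψ_pos hτ] with q hqθ hψq
    exact ⟨hqθ, Real.rpow_neg_one (q : ℝ) ▸ hψq⟩
  obtain ⟨X, P, μ, hX, hP, hμ, hμB, hμP, C, hC⟩ := exists_measure_nearSet (s := τ + 2 * ε)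
    (σ := s / 2) hε0 hε1 hρ (by linarith) (by linarith) (by linarith) hE θ
    (eventually_rpow_neg_le_half_rpow_mul hψ_order hψ_pos hε0) hlarge (1 / 2)
    (show (0 : ℝ) < 1 / 4 by norm_num)
  refine ⟨μ, hμ, ⟨Metric.closedBall (1 / 2) (1 / 4) ∩ ⋂ k, nearSet θ
    (fun q => (1 - (q : ℝ) ^ (-ε) / 2) * ψ q) (fun q => (q : ℝ) ^ (-ε) / 2 * ψ q) (P k),
    ?_, ?_, ?_⟩, C, fun ξ hξ => ?_⟩
  · exact (isCompact_closedBall _ _).inter_right (isClosed_iInter fun k =>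
      isClosed_nearSet _ _ _ fun q hq => ((hP k).1.prime q hq).pos)
  · rintro x ⟨hx, hxP⟩
    exact mem_Exact_of_mem_nearSet hg hc hsep hψ_pos (hψ_order.eventually_le hψ_pos hτ') hτ'1
      (by nlinarith) hbg hε0 hε1 hρ hX (fun k => (hP k).1) (fun k => (hP k).2) hx
      (Set.mem_iInter.1 hxP)
  · rw [Set.compl_inter, Set.compl_iInter]
    exact measure_union_null hμB (measure_iUnion_null hμP)
  · have hC0 : 0 ≤ C := nonneg_of_mul_nonneg_left ((norm_nonneg _).trans (hC 0)) (by positivity)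
    rw [neg_div]
    refine (hC ξ).trans (mul_le_mul_of_nonneg_left ?_ hC0)
    exact Real.rpow_le_rpow_of_nonpos (abs_pos.2 hξ) (by linarith) (by linarith)

lemma SupportsFourierDecay.exists_isNormalNumber {E : Set ℝ} {s : ℝ}
    (h : SupportsFourierDecay E s) (hs : 0 < s) : ∃ x ∈ E, IsNormalNumber x := by
  obtain ⟨μ, hμ, ⟨K, -, hKE, hμK⟩, C, hC⟩ := h
  have hnormal : ∀ᵐ x ∂μ, IsNormalNumber x :=
    ae_isNormalNumber (half_pos hs) fun ξ hξ => neg_div 2 s ▸ hC ξ hξ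
  obtain ⟨x, hx, hxK⟩ := (hnormal.and (mem_ae_iff.2 hμK)).exists
  exact ⟨x, hKE hxK, hx⟩

lemma le_fourierDim {E : Set ℝ} {α : ℝ} (hα0 : 0 < α) (hα1 : α ≤ 1)
    (h : ∀ s, 0 ≤ s → s < α → SupportsFourierDecay E s) : α ≤ fourierDim E :=
  le_of_forall_lt_imp_le_of_dense fun s hsα =>
    (le_max_left s 0).trans <| le_csSup ⟨1, fun _ hu => hu.2.1⟩
      ⟨le_max_right s 0, (max_lt hsα hα0).le.trans hα1, h _ (le_max_right s 0) (max_lt hsα hα0)⟩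

lemma sq_gt_of_threshold {γ τ : ℝ} (hγ : 1 ≤ γ)
    (hτ : (2 + γ ^ 2 + Real.sqrt ((2 + γ ^ 2) ^ 2 - 4)) / 2 < τ) :
    2 < τ ∧ γ ^ 2 * τ < (τ - 1) ^ 2 := by
  have hγ2 : 1 ≤ γ ^ 2 := one_le_pow₀ hγ
  have hroot := Real.sqrt_nonneg ((2 + γ ^ 2) ^ 2 - 4)
  have hsq : Real.sqrt ((2 + γ ^ 2) ^ 2 - 4) ^ 2 = (2 + γ ^ 2) ^ 2 - 4 :=
    Real.sq_sqrt (by nlinarith)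
  exact ⟨by nlinarith, by nlinarith⟩

lemma exponent_mem_Ioc {τ β : ℝ} (hτ : 2 ≤ τ) (hβ : τ < β) :
    2 * (β - τ) / (τ * (β - 1)) ∈ Set.Ioc 0 1 := by
  have hden : 0 < τ * (β - 1) := mul_pos (by linarith) (by linarith)
  exact ⟨div_pos (by linarith) hden, (div_le_one hden).2 (by nlinarith)⟩

end ExactOrder

theorem theorem1_general (θ γ τ β α : ℝ) (ψ : ℕ → ℝ)
    (hγ : (θ = 0 ∧ γ = 1) ∨ (Irrational θ ∧ ExactOrder.HasDiophantineExponent θ γ))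
    (hψ_pos : ∀ q : ℕ, 1 ≤ q → 0 < ψ q)
    (hψ_order : ExactOrder.HasOrder ψ τ)
    (hτ : (2 + γ ^ 2 + Real.sqrt ((2 + γ ^ 2) ^ 2 - 4)) / 2 < τ)
    (hβ : β = (γ ^ 2)⁻¹ * (τ - 1) ^ 2)
    (hα : α = 2 * (β - τ) / (τ * (β - 1))) :
    0 < α ∧ α ≤ ExactOrder.fourierDim (ExactOrder.Exact ψ θ) ∧
      ∃ x ∈ ExactOrder.Exact ψ θ, ExactOrder.IsNormalNumber x := by
  have hγ1 : 1 ≤ γ := hγ.elim (fun h => h.2.ge) fun h => h.2.one_le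
  obtain ⟨hτ2, hτγ⟩ := ExactOrder.sq_gt_of_threshold hγ1 hτ
  have hβτ : τ < β := by rwa [hβ, ← div_eq_inv_mul, lt_div_iff₀ (by positivity), mul_comm]
  obtain ⟨hα0, hα1⟩ : 0 < α ∧ α ≤ 1 := hα ▸ ExactOrder.exponent_mem_Ioc hτ2.le hβτ
  have hden : 0 < τ * (β - 1) := mul_pos (by linarith) (by linarith)
  have hdecay (s : ℝ) (hs0 : 0 ≤ s) (hsα : s < α) :
      ExactOrder.SupportsFourierDecay (ExactOrder.Exact ψ θ) s :=
    ExactOrder.supportsFourierDecay_Exact hγ (by linarith) hψ_pos hψ_order (by linarith) hβ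
      (by linarith) hs0 (by linarith) ((lt_div_iff₀ hden).1 (hα ▸ hsα))
  exact ⟨hα0, ExactOrder.le_fourierDim hα0 hα1 hdecay,
    (hdecay (α / 2) (by linarith) (by linarith)).exists_isNormalNumber (half_pos hα0)⟩

theorem theorem1 (θ γ τ β α : ℝ) (ψ : ℕ → ℝ)
    (hθ : θ ∈ Set.Ico (0 : ℝ) 1)
    (hγ : (θ = 0 ∧ γ = 1) ∨ (Irrational θ ∧ ExactOrder.HasDiophantineExponent θ γ))
    (hψ_pos : ∀ q : ℕ, 1 ≤ q → 0 < ψ q)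
    (hψ_dec : ∀ q q' : ℕ, 1 ≤ q → q ≤ q' → ψ q' ≤ ψ q)
    (hψ_order : ExactOrder.HasOrder ψ τ)
    (hτ : (2 + γ ^ 2 + Real.sqrt ((2 + γ ^ 2) ^ 2 - 4)) / 2 < τ)
    (hβ : β = (γ ^ 2)⁻¹ * (τ - 1) ^ 2)
    (hα : α = 2 * (β - τ) / (τ * (β - 1))) :
    0 < α ∧ α ≤ ExactOrder.fourierDim (ExactOrder.Exact ψ θ) ∧
      ∃ x ∈ ExactOrder.Exact ψ θ, ExactOrder.IsNormalNumber x :=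
  theorem1_general θ γ τ β α ψ hγ hψ_pos hψ_order hτ hβ hα
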